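/- **Setting.** Let $\chi_1 \pmod{q_1}$ and $\chi_2\pmod{q_2}$ be primitive Dirichlet characters with $\chi_1(-1)\chi_2(-1)=1$ and $N=q_1q_2>1$ (the case that one of the $q_i$ equals $1$, with $\chi_i=1$, is allowed). Write $\tau(\chi)=\sum_{a \bmod q}\chi(a)e(a/q)$ with $e(x)=e^{2\pi i x}$, and $\psi(\gamma)=\chi_1(d)\overline{\chi_2}(d)$ for $\gamma=\begin{pmatrix}a&b\\c&d\end{pmatrix}\in\Gamma_0(N)$. For $z$ in the upper half-plane $\mathbb H$ put $$F_{\chi_1,\chi_2}(z)=c_1z+c_0+\sum_{n\ge1}\Big(\sum_{ab=n}\frac{\chi_1(a)\overline{\chi_2}(b)}{a}\Big)e(nz),\qquad c_1=\delta_{q_1=1}\frac{q_2^2L(2,\chi_2)}{2\pi i\,\tau(\chi_2)},\quad c_0=\delta_{q_2=1}\tfrac12L(1,\chi_1),$$ and let $\phi_{\chi_1,\chi_2}(\gamma,z)=F_{\chi_1,\chi_2}(\gamma z)-\psi(\gamma)F_{\chi_1,\chi_2}(z)$. The newform Dedekind sum is $S_{\chi_1,\chi_2}(\gamma)=\frac{\tau(\overline{\chi_1})}{\pi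 i}\phi_{\chi_1,\chi_2}(\gamma,z)$ for $\gamma\in\Gamma_0(N)$. Let $N=QR$ with positive integers $Q,R$, $(Q,R)=1$. Each $\chi_i$ factors uniquely as $\chi_i=\chi_i^{(Q)}\chi_i^{(R)}$ with $\chi_i^{(Q)}$ a character modulo $(q_i,Q)$ and $\chi_i^{(R)}$ a character modulo $(q_i,R)$. Put $\chi_1'=\chi_2^{(Q)}\chi_1^{(R)}$, a character modulo $(q_2,Q)(q_1,R)$, and $\chi_2'=\chi_1^{(Q)}\chi_2^{(R)}$, a character modulo $(q_1,Q)(q_2,R)$. Given $r_0,u_0\in\mathbb Z$ with $(r_0,R)=(u_0,Q)=1$, an Atkin–Lehner operator $W_Q$ is a matrix $$W_Q=\begin{pmatrix}Qr&t\\Nu&Qv\end{pmatrix},\qquad r,t,u,v\in\mathbb Z,\quad r\equiv r_0\ (\mathrm{mod}\ R),\quad u\equiv u_0\ (\mathrm{mod}\ Q),\quad Qrv-Rut=1.$$ **Theorem 1.1 (Simplified Reciprocity Formula).** 1. For every $\gamma\in\Gamma_0(N)$ the value $\phi_{\chi_1,\chi_2}(\gamma,z)$ does not depend on $z\in\mathbb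 H$, so $S_{\chi_1,\chi_2}(\gamma)$ is well defined. 2. For every $Q,R$ and $W_Q$ as above: for each $\gamma\in\Gamma_1(N)$ there is a unique $\gamma'\in\Gamma_1(N)$ with $W_Q\gamma=\gamma'W_Q$, and there is a complex number $\xi$ with $|\xi|=1$, depending only on $\chi_1,\chi_2,Q$ and $W_Q$ (and not on $\gamma$), such that for all such $\gamma,\gamma'$ $$S_{\chi_1,\chi_2}(\gamma')=\xi\,S_{\chi_1',\chi_2'}(\gamma).$$ 3. For the Fricke involution $W_N=\begin{pmatrix}0&-1\\N&0\end{pmatrix}$ and $\gamma,\gamma'\in\Gamma_1(N)$ with $W_N\gamma=\gamma'W_N$ one has $$S_{\chi_1,\chi_2}(\gamma)=\pm S_{\chi_2,\chi_1}(\gamma'),$$ with sign $+$ if both $\chi_i$ are even and $-$ if both are odd. -/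

import Mathlib

noncomputable section

namespace NewformDedekind

open Complex
open scoped MatrixGroups

/-! ## The `Q`-part and the `R`-part of a Dirichlet character -/

instance neZero_gcd (q Q : ℕ) [NeZero q] : NeZero (q.gcd Q) :=
  ⟨Nat.gcd_ne_zero_left (NeZero.ne q)⟩

theorem eq_gcd_mul_gcd {q Q R : ℕ} (hQR : Q.Coprime R) (hq : q ∣ Q * R) :
    q = q.gcd Q * q.gcd R := by
  rw [← hQR.gcd_mul q, Nat.gcd_eq_left hq]

theorem coprime_gcd_gcd {Q R : ℕ} (q : ℕ) (hQR : Q.Coprime R) :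
    (q.gcd Q).Coprime (q.gcd R) :=
  (hQR.coprime_dvd_left (Nat.gcd_dvd_right q Q)).coprime_dvd_right (Nat.gcd_dvd_right q R)

/-- The Chinese remainder isomorphism `(ℤ/q)ˣ ≃ (ℤ/(q,Q))ˣ × (ℤ/(q,R))ˣ`. -/
def crtUnits {q Q R : ℕ} (hQR : Q.Coprime R) (hq : q ∣ Q * R) :
    (ZMod q)ˣ ≃* (ZMod (q.gcd Q))ˣ × (ZMod (q.gcd R))ˣ :=
  (Units.mapEquiv ((ZMod.ringEquivCongr (eq_gcd_mul_gcd hQR hq)).trans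
    (ZMod.chineseRemainder (coprime_gcd_gcd q hQR))).toMulEquiv).trans MulEquiv.prodUnits

theorem crtUnits_apply {q Q R : ℕ} (hQR : Q.Coprime R) (hq : q ∣ Q * R) (a : (ZMod q)ˣ) :
    crtUnits hQR hq a =
      (ZMod.unitsMap (Nat.gcd_dvd_left q Q) a, ZMod.unitsMap (Nat.gcd_dvd_left q R) a) := by
  let e := (ZMod.ringEquivCongr (eq_gcd_mul_gcd hQR hq)).trans
    (ZMod.chineseRemainder (coprime_gcd_gcd q hQR))
  have h1 : (RingHom.fst _ _).comp e.toRingHom =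
      ZMod.castHom (Nat.gcd_dvd_left q Q) (ZMod (q.gcd Q)) := Subsingleton.elim _ _
  have h2 : (RingHom.snd _ _).comp e.toRingHom =
      ZMod.castHom (Nat.gcd_dvd_left q R) (ZMod (q.gcd R)) := Subsingleton.elim _ _
  refine Prod.ext (Units.ext ?_) (Units.ext ?_)
  · exact congrArg (fun f => f (a : ZMod q)) h1
  · exact congrArg (fun f => f (a : ZMod q)) h2

/-- The `Q`-part `χ^{(Q)}`, a character modulo `(q, Q)`: its value at a unit `a` is `χ x`, where
`x ≡ a` modulo `(q, Q)` and `x ≡ 1` modulo `(q, R)`. -/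
def partQ {q Q R : ℕ} (hQR : Q.Coprime R) (hq : q ∣ Q * R) (χ : DirichletCharacter ℂ q) :
    DirichletCharacter ℂ (q.gcd Q) :=
  MulChar.ofUnitHom (χ.toUnitHom.comp
    ((crtUnits hQR hq).symm.toMonoidHom.comp (MonoidHom.inl _ _)))

/-- The `R`-part `χ^{(R)}`, a character modulo `(q, R)`. -/
def partR {q Q R : ℕ} (hQR : Q.Coprime R) (hq : q ∣ Q * R) (χ : DirichletCharacter ℂ q) :
    DirichletCharacter ℂ (q.gcd R) :=
  MulChar.ofUnitHom (χ.toUnitHom.comp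
    ((crtUnits hQR hq).symm.toMonoidHom.comp (MonoidHom.inr _ _)))

/-- The factorization `χ = χ^{(Q)} χ^{(R)}`. -/
theorem partQ_mul_partR {q Q R : ℕ} (hQR : Q.Coprime R) (hq : q ∣ Q * R)
    (χ : DirichletCharacter ℂ q) :
    DirichletCharacter.changeLevel (Nat.gcd_dvd_left q Q) (partQ hQR hq χ) *
      DirichletCharacter.changeLevel (Nat.gcd_dvd_left q R) (partR hQR hq χ) = χ := by
  refine MulChar.ext fun a => ?_
  have key : (crtUnits hQR hq).symm (ZMod.unitsMap (Nat.gcd_dvd_left q Q) a, 1) *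
      (crtUnits hQR hq).symm (1, ZMod.unitsMap (Nat.gcd_dvd_left q R) a) = a := by
    rw [← map_mul, MulEquiv.symm_apply_eq, crtUnits_apply]
    simp
  conv_rhs => rw [← key]
  simp [DirichletCharacter.changeLevel_def, partQ, partR]

/-- The factorization of `χ` into characters modulo `(q, Q)` and `(q, R)` is unique. -/
theorem eq_partQ_and_eq_partR {q Q R : ℕ} (hQR : Q.Coprime R) (hq : q ∣ Q * R)
    (χ : DirichletCharacter ℂ q) (f : DirichletCharacter ℂ (q.gcd Q))
    (g : DirichletCharacter ℂ (q.gcd R))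
    (h : DirichletCharacter.changeLevel (Nat.gcd_dvd_left q Q) f *
      DirichletCharacter.changeLevel (Nat.gcd_dvd_left q R) g = χ) :
    f = partQ hQR hq χ ∧ g = partR hQR hq χ := by
  subst h
  constructor
  · refine MulChar.ext fun a => ?_
    obtain ⟨x, hx⟩ := (crtUnits hQR hq).surjective (a, 1)
    have hx' := hx
    rw [crtUnits_apply, Prod.mk.injEq] at hx'
    have hs : (crtUnits hQR hq).symm (a, 1) = x := by rw [← hx, MulEquiv.symm_apply_apply]
    simp [DirichletCharacter.changeLevel_def, partQ, hs, hx'.1, hx'.2]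
  · refine MulChar.ext fun a => ?_
    obtain ⟨x, hx⟩ := (crtUnits hQR hq).surjective (1, a)
    have hx' := hx
    rw [crtUnits_apply, Prod.mk.injEq] at hx'
    have hs : (crtUnits hQR hq).symm (1, a) = x := by rw [← hx, MulEquiv.symm_apply_apply]
    simp [DirichletCharacter.changeLevel_def, partR, hs, hx'.1, hx'.2]

/-- For `χ` modulo `q` and `η` modulo `q'`, the product `η^{(Q)} χ^{(R)}` as a character modulo
`(q', Q) (q, R)`: the character `χ` with its `Q`-part replaced by that of `η`. Thus
`χ₁' = exchange χ₁ χ₂` and `χ₂' = exchange χ₂ χ₁`. -/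
def exchange {q q' Q R : ℕ} (hQR : Q.Coprime R) (hq : q ∣ Q * R) (hq' : q' ∣ Q * R)
    (χ : DirichletCharacter ℂ q) (η : DirichletCharacter ℂ q') :
    DirichletCharacter ℂ (q'.gcd Q * q.gcd R) :=
  DirichletCharacter.changeLevel (Nat.dvd_mul_right _ _) (partQ hQR hq' η) *
    DirichletCharacter.changeLevel (Nat.dvd_mul_left _ _) (partR hQR hq χ)

/-! ## Newform Dedekind sums -/

/-- The Gauss sum `τ(χ) = ∑_{a mod q} χ(a) e(a/q)`. -/
def tau {q : ℕ} [NeZero q] (χ : DirichletCharacter ℂ q) : ℂ :=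
  gaussSum χ (ZMod.stdAddChar (N := q))

/-- The coefficient `λ_{χ₁,χ₂}(n,1) / √n` for `n ≥ 1`. It equals `∑_{ab=n} χ₁(a) conj(χ₂(b)) / a`,
because `(b/a)^{1/2} / (ab)^{1/2} = 1/a`; the inverse of a Dirichlet character is its conjugate. -/
def coeff {q₁ q₂ : ℕ} (χ₁ : DirichletCharacter ℂ q₁) (χ₂ : DirichletCharacter ℂ q₂) (n : ℕ) : ℂ :=
  ∑ p ∈ n.divisorsAntidiagonal, χ₁ (p.1 : ZMod q₁) * χ₂⁻¹ (p.2 : ZMod q₂) / (p.1 : ℂ)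

/-- The linear coefficient `c₁ = δ_{q₁=1} q₂² L(2, χ₂) / (2πi τ(χ₂))`. -/
def cOne {q₁ q₂ : ℕ} [NeZero q₂] (_χ₁ : DirichletCharacter ℂ q₁) (χ₂ : DirichletCharacter ℂ q₂) :
    ℂ :=
  if q₁ = 1 then (q₂ : ℂ) ^ 2 * χ₂.LFunction 2 / (2 * Real.pi * I * tau χ₂) else 0

/-- The constant coefficient `c₀ = δ_{q₂=1} L(1, χ₁) / 2`. -/
def cZero {q₁ q₂ : ℕ} [NeZero q₁] (χ₁ : DirichletCharacter ℂ q₁) (_χ₂ : DirichletCharacter ℂ q₂) :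
    ℂ :=
  if q₂ = 1 then χ₁.LFunction 1 / 2 else 0

/-- `F_{χ₁,χ₂}(z) = c₁ z + c₀ + ∑_{n ≥ 1} (λ_{χ₁,χ₂}(n,1) / √n) e(nz)`. -/
def F {q₁ q₂ : ℕ} [NeZero q₁] [NeZero q₂] (χ₁ : DirichletCharacter ℂ q₁)
    (χ₂ : DirichletCharacter ℂ q₂) (z : UpperHalfPlane) : ℂ :=
  cOne χ₁ χ₂ * (z : ℂ) + cZero χ₁ χ₂ +
    ∑' n : ℕ+, coeff χ₁ χ₂ n * exp (2 * Real.pi * I * ((n : ℕ) : ℂ) * (z : ℂ))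

/-- The character `ψ = χ₁ conj(χ₂)` at the lower-right entry of a matrix. -/
def psi {q₁ q₂ : ℕ} (χ₁ : DirichletCharacter ℂ q₁) (χ₂ : DirichletCharacter ℂ q₂)
    (γ : SL(2, ℤ)) : ℂ :=
  χ₁ ((γ 1 1 : ℤ) : ZMod q₁) * χ₂⁻¹ ((γ 1 1 : ℤ) : ZMod q₂)

/-- `φ_{χ₁,χ₂}(γ, z) = F_{χ₁,χ₂}(γz) - ψ(γ) F_{χ₁,χ₂}(z)`. -/
def phi {q₁ q₂ : ℕ} [NeZero q₁] [NeZero q₂] (χ₁ : DirichletCharacter ℂ q₁)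
    (χ₂ : DirichletCharacter ℂ q₂) (γ : SL(2, ℤ)) (z : UpperHalfPlane) : ℂ :=
  F χ₁ χ₂ (γ • z) - psi χ₁ χ₂ γ * F χ₁ χ₂ z

/-- The newform Dedekind sum `S_{χ₁,χ₂}(γ) = (τ(conj χ₁) / (πi)) φ_{χ₁,χ₂}(γ)`. For `γ` in
`Γ₀(q₁q₂)` the value `φ_{χ₁,χ₂}(γ, z)` does not depend on `z`; it is read off at `z = i`. -/
def dedekindSum {q₁ q₂ : ℕ} [NeZero q₁] [NeZero q₂] (χ₁ : DirichletCharacter ℂ q₁)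
    (χ₂ : DirichletCharacter ℂ q₂) (γ : SL(2, ℤ)) : ℂ :=
  tau χ₁⁻¹ / (Real.pi * I) * phi χ₁ χ₂ γ UpperHalfPlane.I

/-! ## Atkin-Lehner operators -/

/-- `W` is an Atkin-Lehner operator `W_Q^{(r₀,u₀)}` on `Γ₀(QR)`. -/
def IsAtkinLehner (Q R : ℕ) (r₀ u₀ : ℤ) (W : Matrix (Fin 2) (Fin 2) ℤ) : Prop :=
  ∃ r t u v : ℤ, r ≡ r₀ [ZMOD R] ∧ u ≡ u₀ [ZMOD Q] ∧ Q * r * v - R * u * t = 1 ∧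
    W = !![Q * r, t; (Q * R) * u, Q * v]

/-- The Fricke involution. -/
def fricke (N : ℕ) : Matrix (Fin 2) (Fin 2) ℤ := !![0, -1; N, 0]

end NewformDedekind

end

noncomputable section

namespace NewformDedekind

open Complex
open scoped MatrixGroups

/-! ## Sums of division values of the Weierstrass function -/

/-! Up to an explicit constant, F'(z) for the pair (χ₁, χ₂) is the sum of χ₁(c)χ₂(d)℘(c q₂z + d)
over (c, d) modulo N, where ℘ belongs to the lattice spanned by N q₂z and N
(`divisionSum_charWeight`). The weights sum to zero, so the corrections 1/l² in ℘ cancel and a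
weight-two Eisenstein series remains; its Fourier expansion comes from Lipschitz's formula and Gauss
sums.

Such a sum transforms simply: a change of basis permutes the division points, and a homothety k
multiplies ℘ by k⁻² (`divisionSum_of_det_eq_one`). If an integral matrix W thereby carries χ₁ ⊗ χ₂
to a multiple of η₁ ⊗ η₂, the derivatives of F(Wz) and of F for (η₁, η₂) are proportional, and
integration gives F(Wz) = κ F_η(z) + K (`exists_FC_mobius_eq`).

Taking W = γ in Γ₀(N) gives κ = ψ(γ), so φ(γ, z) is the constant K. If Wγ = γ'W with both matrices
in Γ₁(N), then F(γ'Wz) - F(Wz) = F(Wγz) - F(Wz) = κ(F_η(γz) - F_η(z)), and K drops out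
(`phi_mul_eq`). For W_Q, the Chinese remainder theorem shows that the substitution swaps the Q-parts
of the characters and keeps the R-parts (`exists_exchange_multiplier`); |ξ| = 1 then follows from
|τ(χ)| = √q. For W_N the constant is computed exactly from τ(χ)τ(χ⁻¹) = χ(-1)q. -/

theorem weierstrassP_smul {L L' : PeriodPair} {k : ℂ} (hk : k ≠ 0)
    (h : ∀ x, x ∈ L.lattice ↔ k * x ∈ L'.lattice) (w : ℂ) :
    L'.weierstrassP (k * w) = k⁻¹ ^ 2 * L.weierstrassP w := by
  let e : L.lattice ≃ L'.lattice :=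
    { toFun := fun x => ⟨k * x, (h x).1 x.2⟩
      invFun := fun y => ⟨k⁻¹ * y, (h _).2 (by rw [mul_inv_cancel_left₀ hk]; exact y.2)⟩
      left_inv := fun x => Subtype.ext (by simp [hk])
      right_inv := fun y => Subtype.ext (by simp [hk]) }
  -- The convention 1/0 = 0 keeps the comparison term by term valid at lattice points, so no
  -- division point has to be excluded.
  rw [PeriodPair.weierstrassP, PeriodPair.weierstrassP, ← e.tsum_eq, ← tsum_mul_left]
  refine tsum_congr fun x => ?_
  have : (e x : ℂ) = k * x := rfl
  rw [this, ← mul_sub, mul_pow, mul_pow, one_div, one_div, one_div, one_div, mul_inv, mul_inv,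
    inv_pow]
  ring

/-- The value of `℘` at the `N`-division point with coordinates `x`. -/
def divisionValue (L : PeriodPair) (N : ℕ) (x : ZMod N × ZMod N) : ℂ :=
  L.weierstrassP ((x.1.val * L.ω₁ + x.2.val * L.ω₂) / N)

/-- The `f`-weighted sum of the values of `℘` at the `N`-division points. -/
def divisionSum (L : PeriodPair) {N : ℕ} [NeZero N] (f : ZMod N × ZMod N → ℂ) : ℂ :=
  ∑ x, f x * divisionValue L N x

theorem weierstrassP_div_eq_divisionValue (L : PeriodPair) (N : ℕ) [NeZero N] (m n : ℤ) :
    L.weierstrassP ((m * L.ω₁ + n * L.ω₂) / N) = divisionValue L N (m, n) := by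
  have hN : (N : ℂ) ≠ 0 := Nat.cast_ne_zero.2 (NeZero.ne N)
  have key : ∀ a : ℤ, (a : ℂ) = ((a : ZMod N).val : ℂ) + N * ((a / N : ℤ) : ℂ) := fun a => by
    have h1 : (((a : ZMod N).val : ℤ)) = a % N := ZMod.val_intCast a
    have h2 : ((a : ZMod N).val : ℤ) + N * (a / N) = a := by rw [h1]; exact Int.emod_add_mul_ediv a N
    exact_mod_cast h2.symm
  let l : L.lattice := ⟨((m / N : ℤ) : ℂ) * L.ω₁ + ((n / N : ℤ) : ℂ) * L.ω₂,
    PeriodPair.mem_lattice.2 ⟨_, _, rfl⟩⟩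
  have hl : ((m * L.ω₁ + n * L.ω₂) / N : ℂ) =
      (((m : ZMod N).val : ℂ) * L.ω₁ + ((n : ZMod N).val : ℂ) * L.ω₂) / N + l := by
    change _ = _ + (((m / N : ℤ) : ℂ) * L.ω₁ + ((n / N : ℤ) : ℂ) * L.ω₂)
    field_simp
    linear_combination L.ω₁ * key m + L.ω₂ * key n
  rw [hl, L.weierstrassP_add_coe]
  rfl

theorem lattice_iff_of_det_eq_one {L L' : PeriodPair} {k : ℂ} (hk : k ≠ 0) {a b c d : ℤ}
    (hdet : a * d - b * c = 1) (h₁ : L'.ω₁ = k * (a * L.ω₁ + c * L.ω₂))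
    (h₂ : L'.ω₂ = k * (b * L.ω₁ + d * L.ω₂)) (x : ℂ) :
    x ∈ L.lattice ↔ k * x ∈ L'.lattice := by
  have hd : (a * d - b * c : ℂ) = 1 := by exact_mod_cast hdet
  rw [PeriodPair.mem_lattice, PeriodPair.mem_lattice]
  constructor
  · rintro ⟨m, n, rfl⟩
    refine ⟨d * m - b * n, -c * m + a * n, ?_⟩
    rw [h₁, h₂]
    push_cast
    linear_combination k * (m * L.ω₁ + n * L.ω₂) * hd
  · rintro ⟨m, n, h⟩
    refine ⟨a * m + b * n, c * m + d * n, mul_left_cancel₀ hk ?_⟩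
    rw [← h, h₁, h₂]
    push_cast
    ring

/-- A change of basis of determinant one together with a homothety. -/
theorem divisionSum_of_det_eq_one {L L' : PeriodPair} {N : ℕ} [NeZero N] {k ε : ℂ} (hk : k ≠ 0)
    {a b c d : ℤ} (hdet : a * d - b * c = 1) (h₁ : L'.ω₁ = k * (a * L.ω₁ + c * L.ω₂))
    (h₂ : L'.ω₂ = k * (b * L.ω₁ + d * L.ω₂)) {f g : ZMod N × ZMod N → ℂ}
    (hfg : ∀ m n : ℤ, f (m, n) =
      ε * g ((a * m + b * n : ℤ), (c * m + d * n : ℤ))) :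
    divisionSum L' f = k⁻¹ ^ 2 * ε * divisionSum L g := by
  have hd : (a * d - b * c : ZMod N) = 1 := by exact_mod_cast congrArg (Int.cast : ℤ → ZMod N) hdet
  -- Determinant one makes the substitution a permutation of (ℤ/N)² whose inverse is the adjugate.
  -- The point indexed by `x` for `L'` is `k` times the point indexed by `e x` for `L`, up to a
  -- lattice vector.
  let e : ZMod N × ZMod N ≃ ZMod N × ZMod N :=
    { toFun := fun x => (a * x.1 + b * x.2, c * x.1 + d * x.2)
      invFun := fun x => (d * x.1 - b * x.2, -c * x.1 + a * x.2)
      left_inv := fun x => Prod.ext (by linear_combination x.1 * hd) (by linear_combination x.2 * hd)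
      right_inv := fun x =>
        Prod.ext (by linear_combination x.1 * hd) (by linear_combination x.2 * hd) }
  rw [divisionSum, divisionSum, ← e.sum_comp (fun x => g x * divisionValue L N x), Finset.mul_sum]
  refine Finset.sum_congr rfl fun x _ => ?_
  obtain ⟨m, hm⟩ := ZMod.intCast_surjective x.1
  obtain ⟨n, hn⟩ := ZMod.intCast_surjective x.2
  obtain rfl : x = ((m : ZMod N), (n : ZMod N)) := Prod.ext hm.symm hn.symm
  have he : e ((m : ZMod N), (n : ZMod N)) =
      (((a * m + b * n : ℤ) : ZMod N), ((c * m + d * n : ℤ) : ZMod N)) := by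
    simp [e]
  rw [he, hfg, ← weierstrassP_div_eq_divisionValue, ← weierstrassP_div_eq_divisionValue]
  have : ((m * L'.ω₁ + n * L'.ω₂) / N : ℂ) =
      k * ((((a * m + b * n : ℤ) : ℂ) * L.ω₁ + ((c * m + d * n : ℤ) : ℂ) * L.ω₂) / N) := by
    rw [h₁, h₂]
    push_cast
    ring
  rw [this, weierstrassP_smul hk (lattice_iff_of_det_eq_one hk hdet h₁ h₂)]
  ring

/-! ## Expansion of division sums by rows -/

/-- Division with remainder as a bijection. -/
def residueEquiv (N : ℕ) [NeZero N] : ℤ × ZMod N ≃ ℤ where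
  toFun p := p.2.val + N * p.1
  invFun c := (c / N, c)
  left_inv p := by
    have hN : (N : ℤ) ≠ 0 := Int.natCast_ne_zero.2 (NeZero.ne N)
    refine Prod.ext ?_ (by simp)
    have : ((p.2.val : ℤ)) / N = 0 :=
      Int.ediv_eq_zero_of_lt (Int.natCast_nonneg _) (by exact_mod_cast p.2.val_lt)
    change ((p.2.val : ℤ) + N * p.1) / N = p.1
    rw [Int.add_mul_ediv_left _ _ hN, this, zero_add]
  right_inv c := by
    have h1 : (((c : ZMod N).val : ℤ)) = c % N := ZMod.val_intCast c
    simp only [h1]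
    exact Int.emod_add_mul_ediv c N

theorem tsum_eq_tsum_sum_residue {N : ℕ} [NeZero N] {r : ℤ → ℂ} (hr : Summable r) :
    ∑' c, r c = ∑' m : ℤ, ∑ x : ZMod N, r (x.val + N * m) := by
  rw [← (residueEquiv N).tsum_eq,
    Summable.tsum_prod (f := fun p => r (residueEquiv N p)) ((residueEquiv N).summable_iff.2 hr)]
  simp only [tsum_fintype]
  rfl

/-- The period pair `(N τ, N)`. -/
def periodPair (N : ℕ) [NeZero N] (τ : ℂ) (hτ : 0 < τ.im) : PeriodPair where
  ω₁ := N * τ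
  ω₂ := N
  indep := by
    have hN : (N : ℝ) ≠ 0 := Nat.cast_ne_zero.2 (NeZero.ne N)
    rw [LinearIndependent.pair_iff]
    intro s t h
    have h1 := congrArg Complex.im h
    have h2 := congrArg Complex.re h
    simp at h1 h2
    have hs : s = 0 := by simpa [hτ.ne', NeZero.ne N] using h1
    subst hs
    simpa [hN] using h2

theorem summable_row {N : ℕ} [NeZero N] (f : ZMod N → ℂ) (w : ℂ) :
    Summable fun d : ℤ => f d / (w + d) ^ 2 := by
  have h := EisensteinSeries.linear_right_summable w 1 (k := 2) le_rfl
  obtain ⟨C, hC⟩ := (Set.finite_range fun x : ZMod N => ‖f x‖).bddAbove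
  refine Summable.of_norm_bounded (h.norm.mul_left C) fun d => ?_
  rw [div_eq_mul_inv, norm_mul]
  refine mul_le_mul (hC ⟨_, rfl⟩) (le_of_eq ?_) (norm_nonneg _)
    ((norm_nonneg _).trans (hC ⟨(d : ZMod N), rfl⟩))
  simp only [Int.cast_one, one_mul]
  norm_cast

/-- The lattice translates of the division points run through all cτ + d. Since `f` sums to zero,
the corrections 1/l² cancel within each lattice translate; the series grouped in this way converges
unconditionally and may be summed by rows. -/
theorem divisionSum_eq_tsum {N : ℕ} [NeZero N] {τ : ℂ} (hτ : 0 < τ.im)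
    {f : ZMod N × ZMod N → ℂ} (hf : ∑ x, f x = 0)
    (hs : Summable fun c : ℤ => ∑' d : ℤ, f (c, d) / (c * τ + d) ^ 2) :
    divisionSum (periodPair N τ hτ) f = ∑' c : ℤ, ∑' d : ℤ, f (c, d) / (c * τ + d) ^ 2 := by
  have hN : (N : ℂ) ≠ 0 := Nat.cast_ne_zero.2 (NeZero.ne N)
  set L := periodPair N τ hτ with hL
  have h1 : HasSum (fun l : L.lattice => ∑ x : ZMod N × ZMod N,
      f x / (((x.1.val * L.ω₁ + x.2.val * L.ω₂) / N) - l) ^ 2) (divisionSum L f) := by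
    have := hasSum_sum (s := Finset.univ) fun (x : ZMod N × ZMod N) _ =>
      (L.hasSum_weierstrassP ((x.1.val * L.ω₁ + x.2.val * L.ω₂) / N)).mul_left (f x)
    refine this.congr_fun fun l => ?_
    simp only [mul_sub, Finset.sum_sub_distrib, ← Finset.sum_mul, hf, zero_mul, sub_zero,
      div_eq_mul_inv, one_mul]
  -- The lattice is reindexed by l ↦ -l, so that point minus l becomes point plus l.
  have h2 := (L.latticeEquivProd.symm.toEquiv.trans (Equiv.neg _)).hasSum_iff.2 h1
  have h3 : (fun p : ℤ × ℤ => ∑ x : ZMod N × ZMod N,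
      f x / (((x.1.val + N * p.1 : ℤ) : ℂ) * τ + ((x.2.val + N * p.2 : ℤ) : ℂ)) ^ 2) =
      (fun l : L.lattice => ∑ x : ZMod N × ZMod N,
        f x / (((x.1.val * L.ω₁ + x.2.val * L.ω₂) / N) - l) ^ 2) ∘
        (L.latticeEquivProd.symm.toEquiv.trans (Equiv.neg _)) := by
    funext p
    refine Finset.sum_congr rfl fun x _ => ?_
    congr 2
    have h4 : (((L.latticeEquivProd.symm.toEquiv.trans (Equiv.neg _)) p : L.lattice) : ℂ) =
        -(p.1 * L.ω₁ + p.2 * L.ω₂) := by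
      rw [← L.latticeEquiv_symm_apply]
      rfl
    rw [h4]
    have h5 : L.ω₁ = N * τ := rfl
    have h6 : L.ω₂ = N := rfl
    rw [h5, h6]
    push_cast
    field_simp
    ring
  rw [← h3] at h2
  rw [← h2.tsum_eq, h2.summable.tsum_prod, tsum_eq_tsum_sum_residue (N := N) hs]
  refine tsum_congr fun m => ?_
  have hrow : ∀ c : ℤ, Summable fun d : ℤ => f (c, d) / (c * τ + d) ^ 2 := fun c =>
    summable_row (fun y => f (c, y)) _
  simp_rw [fun c => tsum_eq_tsum_sum_residue (N := N) (hrow c)]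
  rw [← Summable.tsum_finsetSum]
  · refine tsum_congr fun n => ?_
    rw [Fintype.sum_prod_type]
    simp
  · intro x _
    have := ((residueEquiv N).summable_iff.2 (hrow (x.val + N * m))).prod
    simpa [tsum_fintype, residueEquiv] using this

/-! ## The `q`-expansion of character-weighted division sums -/

/-- The weight `(c, d) ↦ χ₁(c) χ₂(d)` on `(ℤ/N)²`. -/
def charWeight {N q₁ q₂ : ℕ} (h₁ : q₁ ∣ N) (h₂ : q₂ ∣ N) (χ₁ : DirichletCharacter ℂ q₁)
    (χ₂ : DirichletCharacter ℂ q₂) (x : ZMod N × ZMod N) : ℂ :=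
  χ₁ (ZMod.castHom h₁ _ x.1) * χ₂ (ZMod.castHom h₂ _ x.2)

theorem charWeight_intCast {N q₁ q₂ : ℕ} (h₁ : q₁ ∣ N) (h₂ : q₂ ∣ N) (χ₁ : DirichletCharacter ℂ q₁)
    (χ₂ : DirichletCharacter ℂ q₂) (m n : ℤ) :
    charWeight h₁ h₂ χ₁ χ₂ (m, n) = χ₁ m * χ₂ n := by
  simp only [charWeight, map_intCast]

/-- Multiplication by a unit b with χ(b) ≠ 1 permutes ℤ/N and multiplies the sum by χ(b). -/
theorem sum_castHom_eq_zero {N q : ℕ} [NeZero N] (h : q ∣ N) {χ : DirichletCharacter ℂ q}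
    (hχ : χ ≠ 1) : ∑ x : ZMod N, χ (ZMod.castHom h _ x) = 0 := by
  obtain ⟨a, ha⟩ : ∃ a, χ (a : (ZMod q)ˣ) ≠ 1 := by
    by_contra! H
    exact hχ (MulChar.ext fun a => by simp [H a])
  obtain ⟨b, rfl⟩ := ZMod.unitsMap_surjective h a
  have hb : ((ZMod.unitsMap h b : (ZMod q)ˣ) : ZMod q) = ZMod.castHom h _ (b : ZMod N) := rfl
  rw [hb] at ha
  have := Fintype.sum_bijective _ b.mulLeft_bijective
    (fun x : ZMod N => χ (ZMod.castHom h _ (b * x))) (fun x => χ (ZMod.castHom h _ x)) fun _ => rfl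
  simp only [map_mul, ← Finset.mul_sum] at this
  by_contra hS
  exact ha ((mul_eq_right₀ hS).1 this)

theorem ne_one_of_isPrimitive {q : ℕ} [NeZero q] {χ : DirichletCharacter ℂ q}
    (hχ : χ.IsPrimitive) (hq : q ≠ 1) : χ ≠ 1 := by
  rintro rfl
  rw [DirichletCharacter.isPrimitive_def, DirichletCharacter.conductor_one] at hχ
  exact hq hχ.symm

theorem sum_charWeight_eq_zero {N q₁ q₂ : ℕ} [NeZero N] [NeZero q₁] [NeZero q₂] (h₁ : q₁ ∣ N)
    (h₂ : q₂ ∣ N) {χ₁ : DirichletCharacter ℂ q₁} {χ₂ : DirichletCharacter ℂ q₂}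
    (hχ₁ : χ₁.IsPrimitive) (hχ₂ : χ₂.IsPrimitive) (hN : q₁ * q₂ ≠ 1) :
    ∑ x, charWeight h₁ h₂ χ₁ χ₂ x = 0 := by
  simp only [charWeight, Fintype.sum_prod_type]
  rw [← Fintype.sum_mul_sum]
  by_cases hq : q₁ = 1
  · rw [sum_castHom_eq_zero h₂ (ne_one_of_isPrimitive hχ₂ (by simpa [hq] using hN)), mul_zero]
  · rw [sum_castHom_eq_zero h₁ (ne_one_of_isPrimitive hχ₁ hq), zero_mul]

theorem norm_exp_two_pi_I_mul_lt_one {z : ℂ} (hz : 0 < z.im) : ‖exp (2 * Real.pi * I * z)‖ < 1 := by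
  exact UpperHalfPlane.norm_exp_two_pi_I_lt_one ⟨z, hz⟩

/-- Lipschitz's formula on each class d ≡ x modulo q produces the phases e(kx/q). Their χ-weighted
sum is χ⁻¹(k)τ(χ) for every k, including k not prime to q, because χ is primitive. -/
theorem tsum_row_eq {q : ℕ} [NeZero q] {χ : DirichletCharacter ℂ q} (hχ : χ.IsPrimitive) {w : ℂ}
    (hw : 0 < w.im) :
    ∑' d : ℤ, χ d / (w + d) ^ 2 = -4 * Real.pi ^ 2 / q ^ 2 * tau χ *
      ∑' k : ℕ+, (k : ℂ) * χ⁻¹ (k : ZMod q) * exp (2 * Real.pi * I * (w / q)) ^ (k : ℕ) := by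
  have hq : (q : ℂ) ≠ 0 := Nat.cast_ne_zero.2 (NeZero.ne q)
  have hq' : (0 : ℝ) < q := Nat.cast_pos.2 (NeZero.pos q)
  have him : ∀ x : ZMod q, 0 < ((w + x.val) / q).im := fun x => by
    rw [div_natCast_im, add_im, natCast_im, add_zero]
    exact div_pos hw hq'
  have hsum : ∀ x : ZMod q, Summable fun n : ℤ => χ x / (w + (x.val + q * n : ℤ)) ^ 2 := fun x => by
    refine ((summable_row (N := q) (fun y => χ y) w).comp_injective
      (i := fun n : ℤ => (x.val + q * n : ℤ)) fun a b hab => ?_).congr fun n => by simp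
    simpa [NeZero.ne q] using hab
  have hshift : ∀ (x : ZMod q) (k : ℕ), exp (2 * Real.pi * I * ((w + x.val) / q)) ^ k =
      exp (2 * Real.pi * I * (w / q)) ^ k * ZMod.stdAddChar.mulShift (k : ZMod q) x := fun x k => by
    have : (k : ZMod q) * x = ((k * x.val : ℤ) : ZMod q) := by simp
    rw [AddChar.mulShift_apply, this, ZMod.stdAddChar_coe, ← exp_nat_mul, ← exp_nat_mul, ← exp_add]
    congr 1
    push_cast
    ring
  have hpow : ∀ x : ZMod q, Summable fun k : ℕ+ =>
      (k : ℂ) * exp (2 * Real.pi * I * ((w + x.val) / q)) ^ (k : ℕ) := fun x => by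
    have := (summable_norm_pow_mul_geometric_of_norm_lt_one 1 (norm_exp_two_pi_I_mul_lt_one (him x))).of_norm
    simp only [pow_one] at this
    exact this.comp_injective PNat.coe_injective
  have hrow : ∀ x : ZMod q, ∑' n : ℤ, χ x / (w + (x.val + q * n : ℤ)) ^ 2 =
      -4 * Real.pi ^ 2 / q ^ 2 * ∑' k : ℕ+,
        χ x * ((k : ℂ) * exp (2 * Real.pi * I * ((w + x.val) / q)) ^ (k : ℕ)) := fun x => by
    have := EisensteinSeries.qExpansion_identity_pnat (k := 1) le_rfl ⟨_, him x⟩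
    simp only [pow_one, Nat.factorial_one, Nat.cast_one, div_one] at this
    rw [tsum_mul_left]
    have h2 : (-2 * Real.pi * I : ℂ) ^ (1 + 1) = -4 * Real.pi ^ 2 := by
      ring_nf
      simp
    rw [h2] at this
    have h3 : ∑' n : ℤ, χ x / (w + (x.val + q * n : ℤ)) ^ 2 =
        ∑' n : ℤ, χ x / q ^ 2 * (1 / ((w + x.val) / q + n) ^ (1 + 1)) := by
      refine tsum_congr fun n => ?_
      have : (w + (x.val + q * n : ℤ) : ℂ) = q * ((w + x.val) / q + n) := by
        push_cast
        field_simp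
        ring
      rw [this, mul_pow, div_mul_div_comm, mul_one]
    rw [h3, tsum_mul_left, this]
    ring
  rw [tsum_eq_tsum_sum_residue (N := q) (summable_row (fun y => χ y) w)]
  have h4 : ∀ (x : ZMod q) (n : ℤ), (((x.val + q * n : ℤ)) : ZMod q) = x := fun x n => by simp
  simp only [h4]
  rw [Summable.tsum_finsetSum fun x _ => hsum x]
  simp only [hrow]
  rw [← Finset.mul_sum, ← Summable.tsum_finsetSum fun x _ => (hpow x).mul_left _,
    mul_assoc _ (tau χ), ← tsum_mul_left (a := tau χ)]
  congr 1
  refine tsum_congr fun k => ?_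
  simp only [hshift]
  have := gaussSum_mulShift_of_isPrimitive ZMod.stdAddChar hχ (k : ZMod q)
  rw [tau, show ∀ a b c d : ℂ, a * (b * c * d) = b * d * (c * a) by intros; ring, ← this, gaussSum,
    Finset.mul_sum]
  refine Finset.sum_congr rfl fun x _ => by ring

theorem summable_double {q₁ q₂ : ℕ} [NeZero q₁] [NeZero q₂] (χ₁ : DirichletCharacter ℂ q₁)
    (χ₂ : DirichletCharacter ℂ q₂) {r : ℂ} (hr : ‖r‖ < 1) :
    Summable fun p : ℕ+ × ℕ+ =>
      χ₁ (p.1 : ZMod q₁) * ((p.2 : ℂ) * χ₂ (p.2 : ZMod q₂) * r ^ (p.1 * p.2 : ℕ)) := by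
  refine Summable.of_norm_bounded (summable_prod_mul_pow 1 hr).norm fun p => ?_
  have h1 := χ₁.norm_le_one (p.1 : ZMod q₁)
  have h2 := χ₂.norm_le_one (p.2 : ZMod q₂)
  rw [pow_one, norm_mul, norm_mul, norm_mul, norm_mul]
  calc _ ≤ 1 * (‖((p.2 : ℕ) : ℂ)‖ * 1 * ‖r ^ (p.1 * p.2 : ℕ)‖) := by gcongr
    _ = _ := by ring

theorem natCast_mul_coeff {q₁ q₂ : ℕ} (χ₁ : DirichletCharacter ℂ q₁) (χ₂ : DirichletCharacter ℂ q₂)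
    (n : ℕ) : n * coeff χ₁ χ₂ n =
      ∑ p ∈ n.divisorsAntidiagonal, χ₁ (p.1 : ZMod q₁) * (p.2 * χ₂⁻¹ (p.2 : ZMod q₂)) := by
  rw [coeff, Finset.mul_sum]
  refine Finset.sum_congr rfl fun p hp => ?_
  obtain ⟨h, h0⟩ := Nat.mem_divisorsAntidiagonal.1 hp
  have : (p.1 : ℂ) ≠ 0 := by
    rintro h'
    rw [Nat.cast_eq_zero.1 h', zero_mul] at h
    exact h0 h.symm
  rw [← h]
  push_cast
  field_simp

/-- The pairs (c, k) are grouped by n = ck; the factor n turns the weight 1/c in `coeff` into k. -/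
theorem hasSum_coeff_mul_pow {q₁ q₂ : ℕ} [NeZero q₁] [NeZero q₂] (χ₁ : DirichletCharacter ℂ q₁)
    (χ₂ : DirichletCharacter ℂ q₂) {r : ℂ} (hr : ‖r‖ < 1) :
    HasSum (fun n : ℕ+ => (n : ℂ) * coeff χ₁ χ₂ n * r ^ (n : ℕ))
      (∑' c : ℕ+, χ₁ (c : ZMod q₁) *
        ∑' k : ℕ+, (k : ℂ) * χ₂⁻¹ (k : ZMod q₂) * (r ^ (c : ℕ)) ^ (k : ℕ)) := by
  have h := summable_double χ₁ χ₂⁻¹ hr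
  have h1 := sigmaAntidiagonalEquivProd.hasSum_iff.2 h.hasSum
  rw [h.tsum_prod] at h1
  simp only [tsum_mul_left, pow_mul] at h1
  refine (h1.sigma fun n => hasSum_fintype _).congr_fun fun n => ?_
  rw [natCast_mul_coeff, ← Finset.sum_coe_sort, Finset.sum_mul]
  refine Finset.sum_congr rfl fun p _ => ?_
  have hp := (Nat.mem_divisorsAntidiagonal.1 p.2).1
  simp only [Function.comp, sigmaAntidiagonalEquivProd, Equiv.coe_fn_mk,
    divisorsAntidiagonalFactors, PNat.mk_coe]
  rw [← pow_mul, hp]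
  ring

/-! ## Gauss sums of primitive characters -/

/-- By primitivity χ⁻¹(a)τ(χ) is a twisted Gauss sum for all a, so the product becomes a double sum
of χ(x)e(a(x - 1)/q), in which orthogonality over a leaves only x = 1. -/
theorem tau_mul_gaussSum_inv {q : ℕ} [NeZero q] {χ : DirichletCharacter ℂ q} (hχ : χ.IsPrimitive) :
    tau χ * gaussSum χ⁻¹ (ZMod.stdAddChar (N := q))⁻¹ = q := by
  classical
  have h1 : tau χ * gaussSum χ⁻¹ (ZMod.stdAddChar (N := q))⁻¹ =
      ∑ a : ZMod q, ∑ x : ZMod q, χ x * ZMod.stdAddChar (a * (x - 1)) := by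
    rw [gaussSum, Finset.mul_sum]
    refine Finset.sum_congr rfl fun a _ => ?_
    rw [← mul_assoc, mul_comm _ (χ⁻¹ a), tau, ← gaussSum_mulShift_of_isPrimitive _ hχ, gaussSum,
      Finset.sum_mul]
    refine Finset.sum_congr rfl fun x _ => ?_
    rw [AddChar.mulShift_apply, AddChar.inv_apply, mul_assoc, ← AddChar.map_add_eq_mul]
    ring_nf
  rw [h1, Finset.sum_comm]
  simp only [← Finset.mul_sum, AddChar.sum_mulShift _ (ZMod.isPrimitive_stdAddChar q),
    sub_eq_zero]
  simp

theorem tau_mul_star_tau {q : ℕ} [NeZero q] {χ : DirichletCharacter ℂ q} (hχ : χ.IsPrimitive) :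
    tau χ * star (tau χ) = q := by
  rw [← tau_mul_gaussSum_inv hχ, tau, star_gaussSum_eq]

theorem norm_tau {q : ℕ} [NeZero q] {χ : DirichletCharacter ℂ q} (hχ : χ.IsPrimitive) :
    ‖tau χ‖ = √q := by
  have := congrArg norm (tau_mul_star_tau hχ)
  rw [norm_mul, norm_star, norm_natCast, ← sq] at this
  rw [← this, Real.sqrt_sq (norm_nonneg _)]

theorem tau_ne_zero {q : ℕ} [NeZero q] {χ : DirichletCharacter ℂ q} (hχ : χ.IsPrimitive) :
    tau χ ≠ 0 := by
  intro h
  have := tau_mul_gaussSum_inv hχ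
  rw [h, zero_mul] at this
  exact NeZero.ne q (by exact_mod_cast this.symm)

theorem tau_mul_tau_inv {q : ℕ} [NeZero q] {χ : DirichletCharacter ℂ q} (hχ : χ.IsPrimitive) :
    tau χ * tau χ⁻¹ = χ (-1) * q := by
  have h := gaussSum_mulShift χ⁻¹ (ZMod.stdAddChar (N := q)) (-1)
  have h2 : (ZMod.stdAddChar (N := q)).mulShift ((-1 : (ZMod q)ˣ) : ZMod q) =
      (ZMod.stdAddChar (N := q))⁻¹ := by
    rw [Units.val_neg, Units.val_one, AddChar.inv_mulShift]
  rw [h2] at h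
  have h3 : χ⁻¹ ((-1 : (ZMod q)ˣ) : ZMod q) = χ (-1) := by
    rw [MulChar.inv_apply, Ring.inverse_unit, inv_neg, inv_one, Units.val_neg, Units.val_one]
  rw [h3] at h
  rw [tau, tau, ← h, ← tau_mul_gaussSum_inv hχ, tau]
  ring

/-- Read off from the product τ(χ)τ(χ⁻¹), without first showing that χ⁻¹ is primitive. -/
theorem norm_tau_inv {q : ℕ} [NeZero q] {χ : DirichletCharacter ℂ q} (hχ : χ.IsPrimitive) :
    ‖tau χ⁻¹‖ = √q := by
  have hq : (0 : ℝ) < √q := Real.sqrt_pos.2 (Nat.cast_pos.2 (NeZero.pos q))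
  have h := congrArg norm (tau_mul_tau_inv hχ)
  have h1 : ‖χ (-1)‖ = 1 := by
    have := χ.unit_norm_eq_one (-1)
    simpa using this
  rw [norm_mul, norm_mul, norm_tau hχ, h1, one_mul, norm_natCast] at h
  refine mul_left_cancel₀ hq.ne' ?_
  rw [h, Real.mul_self_sqrt (Nat.cast_nonneg q)]

/-! ## The derivative of `F` is a division sum -/

/-- The derivative of `F`. -/
def derivF {q₁ q₂ : ℕ} [NeZero q₂] (χ₁ : DirichletCharacter ℂ q₁) (χ₂ : DirichletCharacter ℂ q₂)
    (z : ℂ) : ℂ :=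
  cOne χ₁ χ₂ + 2 * Real.pi * I *
    ∑' n : ℕ+, (n : ℂ) * coeff χ₁ χ₂ n * exp (2 * Real.pi * I * z) ^ (n : ℕ)

theorem tsum_int_div_sq {q : ℕ} [NeZero q] {χ : DirichletCharacter ℂ q} (hχ : χ (-1) = 1) :
    ∑' d : ℤ, χ d / (d : ℂ) ^ 2 = 2 * χ.LFunction 2 := by
  have hs : Summable fun d : ℤ => χ d / (d : ℂ) ^ 2 := by
    simpa using summable_row (N := q) (fun y => χ y) 0
  have he : Function.Even fun d : ℤ => χ d / (d : ℂ) ^ 2 := fun d => by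
    have : χ ((-d : ℤ) : ZMod q) = χ d := by
      rw [Int.cast_neg, ← neg_one_mul, map_mul, hχ, one_mul]
    change χ ((-d : ℤ) : ZMod q) / ((-d : ℤ) : ℂ) ^ 2 = χ d / (d : ℂ) ^ 2
    rw [this, Int.cast_neg, neg_sq]
  rw [tsum_int_eq_zero_add_two_mul_tsum_pnat he hs, χ.LFunction_eq_LSeries (by simp), LSeries,
    ← tsum_zero_pnat_eq_tsum_nat]
  · simp only [Int.cast_zero, ne_eq, OfNat.ofNat_ne_zero, not_false_eq_true, zero_pow, div_zero,
      zero_add, LSeries.term_zero, Int.cast_natCast, nsmul_eq_mul, Nat.cast_ofNat]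
    congr 1
    refine tsum_congr fun n => ?_
    rw [LSeries.term_of_ne_zero n.ne_zero]
    norm_cast
  · exact ZMod.LSeriesSummable_of_one_lt_re χ (by simp)

/-- The parameter q₂z cancels the denominator q₂ of `tsum_row_eq`, so row c > 0 is a power series in
e(cz). Rows c and -c agree by parity. Row 0 survives only for q₁ = 1, where it is 2L(2, χ₂) and
accounts for `cOne`. -/
theorem divisionSum_charWeight {N q₁ q₂ : ℕ} [NeZero N] [NeZero q₁] [NeZero q₂] (h₁ : q₁ ∣ N)
    (h₂ : q₂ ∣ N) {χ₁ : DirichletCharacter ℂ q₁} {χ₂ : DirichletCharacter ℂ q₂}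
    (hχ₁ : χ₁.IsPrimitive) (hχ₂ : χ₂.IsPrimitive) (hparity : χ₁ (-1) * χ₂ (-1) = 1)
    (hN : q₁ * q₂ ≠ 1) {z : ℂ} (hz : 0 < z.im) (hz' : 0 < (q₂ * z).im) :
    divisionSum (periodPair N (q₂ * z) hz') (charWeight h₁ h₂ χ₁ χ₂) =
      4 * Real.pi * I * tau χ₂ / q₂ ^ 2 * derivF χ₁ χ₂ z := by
  have hq : (q₂ : ℂ) ≠ 0 := Nat.cast_ne_zero.2 (NeZero.ne q₂)
  have hπ : (Real.pi : ℂ) ≠ 0 := by exact_mod_cast Real.pi_ne_zero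
  have hr := norm_exp_two_pi_I_mul_lt_one hz
  set r := exp (2 * Real.pi * I * z) with hrdef
  let ρ : ℤ → ℂ := fun c => ∑' d : ℤ, charWeight h₁ h₂ χ₁ χ₂ (c, d) / (c * (q₂ * z) + d) ^ 2
  let K : ℂ := -4 * Real.pi ^ 2 / q₂ ^ 2 * tau χ₂
  have hρ : ∀ c : ℤ, ρ c = χ₁ c * ∑' d : ℤ, χ₂ d / (c * (q₂ * z) + d) ^ 2 := fun c => by
    simp only [ρ, charWeight_intCast, mul_div_assoc, tsum_mul_left]
  have heven : Function.Even ρ := fun c => by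
    simp only [hρ]
    rw [← (Equiv.neg ℤ).tsum_eq, Int.cast_neg (R := ZMod q₁), ← neg_one_mul (c : ZMod q₁), map_mul]
    have : ∀ d : ℤ, χ₂ (((Equiv.neg ℤ) d : ℤ) : ZMod q₂) /
        (((-c : ℤ) : ℂ) * (q₂ * z) + ((Equiv.neg ℤ) d : ℤ)) ^ 2 =
        χ₂ (-1) * (χ₂ d / (c * (q₂ * z) + d) ^ 2) := fun d => by
      rw [Equiv.neg_apply, Int.cast_neg (R := ZMod q₂), ← neg_one_mul (d : ZMod q₂), map_mul,
        mul_div_assoc]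
      push_cast
      congr 2
      ring
    simp only [this, tsum_mul_left]
    linear_combination (χ₁ c * ∑' d : ℤ, χ₂ d / (c * (q₂ * z) + d) ^ 2) * hparity
  have hpos : ∀ c : ℕ+, ρ ((c : ℕ) : ℤ) = K * (χ₁ ((c : ℕ) : ZMod q₁) *
      ∑' k : ℕ+, (k : ℂ) * χ₂⁻¹ (k : ZMod q₂) * (r ^ (c : ℕ)) ^ (k : ℕ)) := fun c => by
    have hc : (0 : ℝ) < (c : ℕ) := Nat.cast_pos.2 c.pos
    have him : 0 < (((c : ℕ) : ℤ) * (q₂ * z) : ℂ).im := by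
      rw [Int.cast_natCast, ← ofReal_natCast c, im_ofReal_mul]
      exact mul_pos hc hz'
    rw [hρ, tsum_row_eq hχ₂ him]
    have : exp (2 * Real.pi * I * (((c : ℕ) : ℤ) * (q₂ * z) / q₂)) = r ^ (c : ℕ) := by
      rw [hrdef, ← exp_nat_mul]
      congr 1
      push_cast
      field_simp
    rw [this]
    push_cast
    ring
  have hsum : HasSum (fun c : ℕ+ => ρ ((c : ℕ) : ℤ))
      (K * ∑' n : ℕ+, (n : ℂ) * coeff χ₁ χ₂ n * r ^ (n : ℕ)) := by
    simp only [hpos]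
    refine HasSum.mul_left _ ?_
    rw [(hasSum_coeff_mul_pow χ₁ χ₂ hr).tsum_eq]
    refine Summable.hasSum ?_
    have := (summable_double χ₁ χ₂⁻¹ hr).prod
    simpa only [tsum_mul_left, pow_mul] using this
  have hsρ : Summable ρ := by
    have hnat : Summable fun n : ℕ => ρ n :=
      (summable_pnat_iff_summable_nat (f := fun n : ℕ => ρ n)).1 hsum.summable
    refine hnat.of_nat_of_neg ?_
    simpa only [heven _] using hnat
  rw [divisionSum_eq_tsum hz' (sum_charWeight_eq_zero h₁ h₂ hχ₁ hχ₂ hN) hsρ]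
  change ∑' c, ρ c = _
  rw [tsum_int_eq_zero_add_two_mul_tsum_pnat heven hsρ, hsum.tsum_eq]
  have h0 : ρ 0 = 4 * Real.pi * I * tau χ₂ / q₂ ^ 2 * cOne χ₁ χ₂ := by
    rw [hρ, cOne]
    split_ifs with h
    · subst h
      have hχ : χ₁ = 1 := DirichletCharacter.level_one χ₁
      subst hχ
      have hone : ∀ a : ZMod 1, (1 : DirichletCharacter ℂ 1) a = 1 := fun a => by
        rw [Subsingleton.elim a 1, map_one]
      rw [hone, one_mul] at hparity
      rw [hone, one_mul]
      simp only [Int.cast_zero, zero_mul, zero_add]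
      rw [tsum_int_div_sq hparity]
      have := tau_ne_zero hχ₂
      field_simp
      ring
    · rw [Int.cast_zero, χ₁.map_zero' h, zero_mul, mul_zero]
  rw [h0, derivF, ← hrdef]
  simp only [K, nsmul_eq_mul]
  generalize ∑' n : ℕ+, (n : ℂ) * coeff χ₁ χ₂ n * r ^ (n : ℕ) = T
  push_cast
  linear_combination (-8 * Real.pi ^ 2 / q₂ ^ 2 * tau χ₂ * T) * I_sq

/-! ## Transformation of `F` under integral matrices -/

/-- The series defining `F`, as a function on `ℂ`. -/
def FC {q₁ q₂ : ℕ} [NeZero q₁] [NeZero q₂] (χ₁ : DirichletCharacter ℂ q₁)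
    (χ₂ : DirichletCharacter ℂ q₂) (z : ℂ) : ℂ :=
  cOne χ₁ χ₂ * z + cZero χ₁ χ₂ +
    ∑' n : ℕ+, coeff χ₁ χ₂ n * exp (2 * Real.pi * I * ((n : ℕ) : ℂ) * z)

theorem hasDerivAt_FC {q₁ q₂ : ℕ} [NeZero q₁] [NeZero q₂] (χ₁ : DirichletCharacter ℂ q₁)
    (χ₂ : DirichletCharacter ℂ q₂) {z : ℂ} (hz : 0 < z.im) :
    HasDerivAt (FC χ₁ χ₂) (derivF χ₁ χ₂ z) z := by
  have hexp : ∀ (n : ℕ) (w : ℂ), exp (2 * Real.pi * I * n * w) = exp (2 * Real.pi * I * w) ^ n :=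
    fun n w => by
      rw [← exp_nat_mul]
      congr 1
      ring
  have hnorm : ∀ w : ℂ, ‖exp (2 * Real.pi * I * w)‖ = Real.exp (-(2 * Real.pi * w.im)) := fun w => by
    rw [norm_exp]
    simp
  have him : 0 < (z - z.im / 2 * I).im := by
    simp
    linarith
  -- On the half-plane Im w > Im z / 2 the differentiated series is dominated by its absolute values
  -- at height Im z / 2, which is what `r` encodes.
  set r := exp (2 * Real.pi * I * (z - z.im / 2 * I)) with hr
  have hs := ((hasSum_coeff_mul_pow χ₁ χ₂ (norm_exp_two_pi_I_mul_lt_one him)).summable.norm).mul_left (2 * Real.pi)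
  have hconv : Convex ℝ {w : ℂ | z.im / 2 < w.im} := convex_halfSpace_im_gt _
  have hmem : z ∈ {w : ℂ | z.im / 2 < w.im} := by
    change z.im / 2 < z.im
    linarith
  have hsum : Summable fun n : ℕ+ => coeff χ₁ χ₂ n * exp (2 * Real.pi * I * ((n : ℕ) : ℂ) * z) := by
    refine Summable.of_norm_bounded
      (hasSum_coeff_mul_pow χ₁ χ₂ (norm_exp_two_pi_I_mul_lt_one hz)).summable.norm fun n => ?_
    rw [hexp, mul_assoc (n : ℂ), norm_mul (n : ℂ), norm_natCast]
    exact le_mul_of_one_le_left (norm_nonneg _) (Nat.one_le_cast.2 n.pos)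
  have hd := hasDerivAt_tsum_of_isPreconnected (𝕜 := ℂ)
    (g := fun (n : ℕ+) (w : ℂ) => coeff χ₁ χ₂ n * exp (2 * Real.pi * I * ((n : ℕ) : ℂ) * w))
    (g' := fun (n : ℕ+) (w : ℂ) =>
      2 * Real.pi * I * ((n : ℂ) * coeff χ₁ χ₂ n * exp (2 * Real.pi * I * w) ^ (n : ℕ)))
    hs (isOpen_lt continuous_const continuous_im) hconv.isPreconnected
    (fun n w _ => by
      have := (((hasDerivAt_id w).const_mul (2 * Real.pi * I * ((n : ℕ) : ℂ))).cexp).const_mul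
        (coeff χ₁ χ₂ n)
      refine this.congr_deriv ?_
      simp only [id]
      rw [hexp]
      ring)
    (fun n w hw => by
      rw [norm_mul (2 * Real.pi * I : ℂ), norm_mul ((n : ℂ) * _), norm_mul ((n : ℂ) * _)]
      have h2 : ‖(2 * Real.pi * I : ℂ)‖ = 2 * Real.pi := by
        simp [abs_of_pos Real.pi_pos]
      rw [h2, norm_pow, norm_pow, hnorm, hnorm]
      gcongr
      have : (z - z.im / 2 * I).im = z.im / 2 := by
        simp
        ring
      rw [this]
      exact le_of_lt hw)
    hmem hsum hmem
  refine ((((hasDerivAt_id z).const_mul (cOne χ₁ χ₂)).add_const (cZero χ₁ χ₂)).add hd).congr_deriv ?_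
  rw [derivF, tsum_mul_left, mul_one]

theorem linear_ne_zero {A B C D : ℤ} (hΔ : 0 < A * D - B * C) {z : ℂ} (hz : 0 < z.im) :
    (C * z + D : ℂ) ≠ 0 := by
  intro h
  have h1 := congrArg im h
  have h2 := congrArg re h
  simp at h1 h2
  obtain rfl : C = 0 := h1.resolve_right hz.ne'
  obtain rfl : D = 0 := by simpa using h2
  simp at hΔ

theorem mobius_im_pos {A B C D : ℤ} (hΔ : 0 < A * D - B * C) {z : ℂ} (hz : 0 < z.im) :
    0 < ((A * z + B) / (C * z + D) : ℂ).im := by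
  have h := normSq_pos.2 (linear_ne_zero hΔ hz)
  have hΔ' : (0 : ℝ) < A * D - B * C := by exact_mod_cast hΔ
  have : ((A * z + B) / (C * z + D) : ℂ).im =
      (A * D - B * C) * z.im / normSq (C * z + D) := by
    rw [div_im, ← sub_div]
    simp
    ring
  rw [this]
  positivity

theorem mobius_mobius {A B C D a b c d : ℤ} {z : ℂ} (h : (c * z + d : ℂ) ≠ 0) :
    ((A * ((a * z + b) / (c * z + d)) + B) / (C * ((a * z + b) / (c * z + d)) + D) : ℂ) =
      (((A * a + B * c : ℤ) : ℂ) * z + (A * b + B * d : ℤ)) /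
        (((C * a + D * c : ℤ) : ℂ) * z + (C * b + D * d : ℤ)) := by
  have key : ∀ X Y : ℤ, (X * ((a * z + b) / (c * z + d)) + Y : ℂ) =
      (((X * a + Y * c : ℤ) : ℂ) * z + (X * b + Y * d : ℤ)) / (c * z + d) := fun X Y => by
    rw [eq_div_iff h, add_mul, mul_assoc, div_mul_cancel₀ _ h]
    push_cast
    ring
  rw [key, key, div_div_div_cancel_right₀ h]

/-- If the linear substitution induced by an integral matrix carries the weight `χ₁ ⊗ χ₂` to
`η₁ ⊗ η₂`, then it carries `F` for `(χ₁, χ₂)` to a multiple of `F` for `(η₁, η₂)`, up to an additive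
constant. -/
theorem exists_FC_mobius_eq {N q₁ q₂ p₁ p₂ : ℕ} [NeZero N] [NeZero q₁] [NeZero q₂] [NeZero p₁]
    [NeZero p₂] (hq₁ : q₁ ∣ N) (hq₂ : q₂ ∣ N) (hp₁ : p₁ ∣ N) (hp₂ : p₂ ∣ N)
    {χ₁ : DirichletCharacter ℂ q₁} {χ₂ : DirichletCharacter ℂ q₂}
    {η₁ : DirichletCharacter ℂ p₁} {η₂ : DirichletCharacter ℂ p₂}
    (hχ₁ : χ₁.IsPrimitive) (hχ₂ : χ₂.IsPrimitive) (hη₁ : η₁.IsPrimitive) (hη₂ : η₂.IsPrimitive)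
    (hχ : χ₁ (-1) * χ₂ (-1) = 1) (hη : η₁ (-1) * η₂ (-1) = 1) (hq : q₁ * q₂ ≠ 1)
    (hp : p₁ * p₂ ≠ 1) {A B C D : ℤ} (hΔ : 0 < A * D - B * C) {k : ℕ} [NeZero k] {a b c d : ℤ}
    (hdet : a * d - b * c = 1) (hA : q₂ * A = k * a * p₂) (hB : q₂ * B = k * c)
    (hC : C = k * b * p₂) (hD : D = k * d) {ε : ℂ}
    (hε : ∀ m n : ℤ, χ₁ m * χ₂ n =
      ε * (η₁ ((a * m + b * n : ℤ) : ZMod p₁) * η₂ ((c * m + d * n : ℤ) : ZMod p₂))) :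
    ∃ K : ℂ, ∀ z : ℂ, 0 < z.im → FC χ₁ χ₂ ((A * z + B) / (C * z + D)) =
      (A * D - B * C) * ε / k ^ 2 * (q₂ ^ 2 / tau χ₂) * (tau η₂ / p₂ ^ 2) * FC η₁ η₂ z + K := by
  have hk : (k : ℂ) ≠ 0 := Nat.cast_ne_zero.2 (NeZero.ne k)
  have hq0 : (q₂ : ℂ) ≠ 0 := Nat.cast_ne_zero.2 (NeZero.ne q₂)
  have hp0 : (p₂ : ℂ) ≠ 0 := Nat.cast_ne_zero.2 (NeZero.ne p₂)
  have hpos : ∀ (q : ℕ) [NeZero q] {w : ℂ}, 0 < w.im → 0 < (q * w : ℂ).im := fun q _ w hw => by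
    rw [← ofReal_natCast, im_ofReal_mul]
    exact mul_pos (Nat.cast_pos.2 (NeZero.pos q)) hw
  set κ : ℂ := (A * D - B * C) * ε / k ^ 2 * (q₂ ^ 2 / tau χ₂) * (tau η₂ / p₂ ^ 2) with hκ
  have hderiv : ∀ z : ℂ, 0 < z.im →
      HasDerivAt (fun z : ℂ => FC χ₁ χ₂ ((A * z + B) / (C * z + D)) - κ * FC η₁ η₂ z) 0 z := by
    intro z hz
    have hj := linear_ne_zero hΔ hz
    have hw := mobius_im_pos hΔ hz
    -- The conditions `hA` to `hD` say diag(q₂, 1)·W = k·(a c; b d)·diag(p₂, 1). Hence the lattice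
    -- at q₂·Wz is k/(Cz + D) times the lattice at p₂z, written in another basis.
    have key := divisionSum_of_det_eq_one (N := N) (ε := ε)
      (L := periodPair N (p₂ * z) (hpos p₂ hz))
      (L' := periodPair N (q₂ * ((A * z + B) / (C * z + D))) (hpos q₂ hw))
      (k := k / (C * z + D)) (div_ne_zero hk hj) hdet
      (by
        change (N * (q₂ * ((A * z + B) / (C * z + D))) : ℂ) =
          k / (C * z + D) * (a * (N * (p₂ * z)) + c * N)
        have hA' : (q₂ * A : ℂ) = k * a * p₂ := by exact_mod_cast hA
        have hB' : (q₂ * B : ℂ) = k * c := by exact_mod_cast hB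
        rw [mul_div_assoc', mul_div_assoc', div_mul_eq_mul_div]
        congr 1
        linear_combination N * z * hA' + N * hB')
      (by
        change (N : ℂ) = k / (C * z + D) * (b * (N * (p₂ * z)) + d * N)
        have hC' : (C : ℂ) = k * b * p₂ := by exact_mod_cast hC
        have hD' : (D : ℂ) = k * d := by exact_mod_cast hD
        rw [div_mul_eq_mul_div, eq_div_iff hj]
        linear_combination N * z * hC' + N * hD')
      (f := charWeight hq₁ hq₂ χ₁ χ₂) (g := charWeight hp₁ hp₂ η₁ η₂)
      (fun m n => by rw [charWeight_intCast, charWeight_intCast]; exact hε m n)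
    rw [divisionSum_charWeight hq₁ hq₂ hχ₁ hχ₂ hχ hq hw,
      divisionSum_charWeight hp₁ hp₂ hη₁ hη₂ hη hp hz] at key
    have hm : HasDerivAt (fun z : ℂ => (A * z + B) / (C * z + D))
        ((A * D - B * C) / (C * z + D) ^ 2) z := by
      have h1 := ((hasDerivAt_id z).const_mul (A : ℂ)).add_const (B : ℂ)
      have h2 := ((hasDerivAt_id z).const_mul (C : ℂ)).add_const (D : ℂ)
      refine (h1.div h2 hj).congr_deriv ?_
      simp only [id]
      ring
    have h1 := (hasDerivAt_FC χ₁ χ₂ hw).comp z hm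
    have h2 := (hasDerivAt_FC η₁ η₂ hz).const_mul κ
    -- The factor (Cz + D)² from the homothety cancels the denominator in the derivative of the
    -- Möbius map, leaving the constant `κ`.
    refine (h1.sub h2).congr_deriv ?_
    have hπ : (4 * Real.pi * I : ℂ) ≠ 0 := by simp [Real.pi_ne_zero]
    have hτ := tau_ne_zero hχ₂
    have hkey : derivF χ₁ χ₂ ((A * z + B) / (C * z + D)) =
        q₂ ^ 2 / tau χ₂ * ((C * z + D) ^ 2 / k ^ 2 * ε * (tau η₂ / p₂ ^ 2 * derivF η₁ η₂ z)) := by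
      refine mul_left_cancel₀ (mul_ne_zero hπ (div_ne_zero hτ (pow_ne_zero 2 hq0))) ?_
      rw [← mul_div_assoc, key]
      field_simp
    rw [hkey, hκ]
    field_simp
    ring
  have hopen : IsOpen {w : ℂ | 0 < w.im} := isOpen_lt continuous_const continuous_im
  have hI : (0 : ℝ) < I.im := by simp
  refine ⟨FC χ₁ χ₂ ((A * I + B) / (C * I + D)) - κ * FC η₁ η₂ I, fun z hz => ?_⟩
  have := hopen.is_const_of_deriv_eq_zero (convex_halfSpace_im_gt 0).isPreconnected
    (fun w hw => (hderiv w hw).differentiableAt.differentiableWithinAt)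
    (fun w hw => (hderiv w hw).deriv) (x := z) (y := I) hz hI
  rw [← this]
  ring

theorem coe_smul_eq (γ : SL(2, ℤ)) (z : UpperHalfPlane) :
    ((γ • z : UpperHalfPlane) : ℂ) =
      (((γ 0 0 : ℤ) : ℂ) * z + (γ 0 1 : ℤ)) / (((γ 1 0 : ℤ) : ℂ) * z + (γ 1 1 : ℤ)) := by
  rw [UpperHalfPlane.coe_specialLinearGroup_apply]
  simp

theorem F_eq_FC {q₁ q₂ : ℕ} [NeZero q₁] [NeZero q₂] (χ₁ : DirichletCharacter ℂ q₁)
    (χ₂ : DirichletCharacter ℂ q₂) (z : UpperHalfPlane) : F χ₁ χ₂ z = FC χ₁ χ₂ z := rfl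

/-! ## Dedekind sums -/

theorem phi_eq_of_mem_Gamma0 {q₁ q₂ : ℕ} [NeZero q₁] [NeZero q₂] {χ₁ : DirichletCharacter ℂ q₁}
    {χ₂ : DirichletCharacter ℂ q₂} (hχ₁ : χ₁.IsPrimitive) (hχ₂ : χ₂.IsPrimitive)
    (hparity : χ₁ (-1) * χ₂ (-1) = 1) (hN : q₁ * q₂ ≠ 1) {γ : SL(2, ℤ)}
    (hγ : γ ∈ CongruenceSubgroup.Gamma0 (q₁ * q₂)) (z w : UpperHalfPlane) :
    phi χ₁ χ₂ γ z = phi χ₁ χ₂ γ w := by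
  obtain ⟨e, he⟩ := (ZMod.intCast_zmod_eq_zero_iff_dvd _ _).1 (CongruenceSubgroup.Gamma0_mem.1 hγ)
  have hdet : γ 0 0 * γ 1 1 - γ 0 1 * γ 1 0 = 1 := by
    rw [← Matrix.det_fin_two, γ.det_coe]
  push_cast at he
  have hunit : ∀ {q : ℕ}, (q : ℤ) ∣ γ 1 0 → ((γ 0 0 : ℤ) : ZMod q) * ((γ 1 1 : ℤ) : ZMod q) = 1 :=
    fun {q} hq => by
      have h0 := (ZMod.intCast_zmod_eq_zero_iff_dvd _ q).2 hq
      have := congrArg (Int.cast : ℤ → ZMod q) hdet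
      push_cast at this
      rwa [h0, mul_zero, sub_zero] at this
  have hu₁ := hunit (q := q₁) ⟨q₂ * e, by rw [he]; ring⟩
  have hu₂ := hunit (q := q₂) ⟨q₁ * e, by rw [he]; ring⟩
  have h1 : χ₁ ((γ 1 1 : ℤ) : ZMod q₁) * χ₁ ((γ 0 0 : ℤ) : ZMod q₁) = 1 := by
    rw [← map_mul, mul_comm, hu₁, map_one]
  have h2 : χ₂⁻¹ ((γ 1 1 : ℤ) : ZMod q₂) * χ₂ ((γ 1 1 : ℤ) : ZMod q₂) = 1 := by
    rw [← MulChar.mul_apply, inv_mul_cancel]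
    exact MulChar.one_apply (IsUnit.of_mul_eq_one _ ((mul_comm _ _).trans hu₂))
  -- Modulo q₁ and q₂ the substitution is diagonal, m ↦ γ₀₀m and n ↦ γ₁₁n. Since γ₀₀γ₁₁ ≡ 1, the
  -- factor undoing χ₁(γ₀₀)χ₂(γ₁₁) is ψ(γ).
  obtain ⟨K, hK⟩ := exists_FC_mobius_eq (dvd_mul_right q₁ q₂) (dvd_mul_left q₂ q₁)
    (dvd_mul_right q₁ q₂) (dvd_mul_left q₂ q₁) hχ₁ hχ₂ hχ₁ hχ₂ hparity hparity hN hN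
    (A := γ 0 0) (B := γ 0 1) (C := γ 1 0) (D := γ 1 1) (by rw [hdet]; exact one_pos) (k := 1)
    (a := γ 0 0) (b := q₁ * e) (c := q₂ * γ 0 1) (d := γ 1 1)
    (by linear_combination hdet + γ 0 1 * he)
    (by push_cast; ring) (by push_cast; ring) (by rw [he]; push_cast; ring)
    (by push_cast; ring) (ε := psi χ₁ χ₂ γ)
    (fun m n => by
      push_cast
      rw [ZMod.natCast_self, ZMod.natCast_self, zero_mul, zero_mul, zero_mul, zero_mul, add_zero,
        zero_add, map_mul, map_mul, psi]
      linear_combination (-χ₁ m * χ₂ n) * (χ₂⁻¹ ((γ 1 1 : ℤ) : ZMod q₂) *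
        χ₂ ((γ 1 1 : ℤ) : ZMod q₂)) * h1 - χ₁ m * χ₂ n * h2)
  have hq : (q₂ : ℂ) ≠ 0 := Nat.cast_ne_zero.2 (NeZero.ne q₂)
  have hτ := tau_ne_zero hχ₂
  have hdet' : ((γ 0 0 : ℤ) * (γ 1 1 : ℤ) - (γ 0 1 : ℤ) * (γ 1 0 : ℤ) : ℂ) = 1 := by
    exact_mod_cast hdet
  have hphi : ∀ z, phi χ₁ χ₂ γ z = K := fun z => by
    rw [phi, F_eq_FC, F_eq_FC, coe_smul_eq, hK z z.im_pos, hdet']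
    field_simp
    push_cast
    ring
  rw [hphi, hphi]

theorem psi_eq_one {N q₁ q₂ : ℕ} (hq₁ : q₁ ∣ N) (hq₂ : q₂ ∣ N) (χ₁ : DirichletCharacter ℂ q₁)
    (χ₂ : DirichletCharacter ℂ q₂) {γ : SL(2, ℤ)} (hγ : γ ∈ CongruenceSubgroup.Gamma1 N) :
    psi χ₁ χ₂ γ = 1 := by
  have h := ((CongruenceSubgroup.Gamma1_mem _ _).1 hγ).2.1
  have hc : ∀ {q : ℕ}, q ∣ N → ((γ 1 1 : ℤ) : ZMod q) = 1 := fun {q} hq => by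
    have := congrArg (ZMod.castHom hq (ZMod q)) h
    rwa [map_intCast, map_one] at this
  rw [psi, hc hq₁, hc hq₂, map_one, map_one, one_mul]

/-- As φ(γ', ·) is constant it may be evaluated at w = Wz, where γ'w = W(γz). With both multipliers
equal to one, `K` cancels in the difference. -/
theorem phi_mul_eq {q₁ q₂ p₁ p₂ : ℕ} [NeZero q₁] [NeZero q₂] [NeZero p₁] [NeZero p₂]
    {χ₁ : DirichletCharacter ℂ q₁} {χ₂ : DirichletCharacter ℂ q₂}
    {η₁ : DirichletCharacter ℂ p₁} {η₂ : DirichletCharacter ℂ p₂} {A B C D : ℤ}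
    (hΔ : 0 < A * D - B * C) {κ K : ℂ}
    (hK : ∀ z : ℂ, 0 < z.im → FC χ₁ χ₂ ((A * z + B) / (C * z + D)) = κ * FC η₁ η₂ z + K)
    {γ γ' : SL(2, ℤ)} (hγ : psi η₁ η₂ γ = 1) (hγ' : psi χ₁ χ₂ γ' = 1)
    (hW : !![A, B; C, D] * (γ : Matrix (Fin 2) (Fin 2) ℤ) =
      (γ' : Matrix (Fin 2) (Fin 2) ℤ) * !![A, B; C, D])
    (hphi : ∀ z w, phi χ₁ χ₂ γ' z = phi χ₁ χ₂ γ' w) (z : UpperHalfPlane) :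
    phi χ₁ χ₂ γ' z = κ * phi η₁ η₂ γ z := by
  let w : UpperHalfPlane := ⟨_, mobius_im_pos hΔ z.im_pos⟩
  have hw : (w : ℂ) = (A * z + B) / (C * z + D) := rfl
  have h00 := congrFun (congrFun hW 0) 0
  have h01 := congrFun (congrFun hW 0) 1
  have h10 := congrFun (congrFun hW 1) 0
  have h11 := congrFun (congrFun hW 1) 1
  simp only [Matrix.mul_apply, Fin.sum_univ_two, Matrix.of_apply, Matrix.cons_val_zero,
    Matrix.cons_val_one, Matrix.cons_val', Matrix.cons_val_fin_one] at h00 h01 h10 h11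
  have hdet : γ 0 0 * γ 1 1 - γ 0 1 * γ 1 0 = 1 := by
    rw [← Matrix.det_fin_two, γ.det_coe]
  have hcomm : ((γ' • w : UpperHalfPlane) : ℂ) =
      (A * ((γ • z : UpperHalfPlane) : ℂ) + B) / (C * ((γ • z : UpperHalfPlane) : ℂ) + D) := by
    rw [coe_smul_eq, coe_smul_eq, hw, mobius_mobius (linear_ne_zero hΔ z.im_pos),
      mobius_mobius (linear_ne_zero (hdet ▸ one_pos) z.im_pos), h00, h01, h10, h11]
  rw [hphi z w, phi, phi, hγ, hγ', F_eq_FC, F_eq_FC, F_eq_FC, F_eq_FC, hcomm, hw,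
    hK _ (γ • z).im_pos, hK _ z.im_pos]
  ring

theorem dedekindSum_eq_of_FC_mobius_eq {q₁ q₂ p₁ p₂ : ℕ} [NeZero q₁] [NeZero q₂] [NeZero p₁]
    [NeZero p₂] {χ₁ : DirichletCharacter ℂ q₁} {χ₂ : DirichletCharacter ℂ q₂}
    {η₁ : DirichletCharacter ℂ p₁} {η₂ : DirichletCharacter ℂ p₂}
    (hχ₁ : χ₁.IsPrimitive) (hχ₂ : χ₂.IsPrimitive) (hη₁ : η₁.IsPrimitive)
    (hparity : χ₁ (-1) * χ₂ (-1) = 1) (hN : q₁ * q₂ ≠ 1) (hp₁ : p₁ ∣ q₁ * q₂) (hp₂ : p₂ ∣ q₁ * q₂)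
    {A B C D : ℤ} (hΔ : 0 < A * D - B * C) {κ K : ℂ}
    (hK : ∀ z : ℂ, 0 < z.im → FC χ₁ χ₂ ((A * z + B) / (C * z + D)) = κ * FC η₁ η₂ z + K)
    {γ γ' : SL(2, ℤ)} (hγ : γ ∈ CongruenceSubgroup.Gamma1 (q₁ * q₂))
    (hγ' : γ' ∈ CongruenceSubgroup.Gamma1 (q₁ * q₂))
    (hW : !![A, B; C, D] * (γ : Matrix (Fin 2) (Fin 2) ℤ) =
      (γ' : Matrix (Fin 2) (Fin 2) ℤ) * !![A, B; C, D]) :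
    dedekindSum χ₁ χ₂ γ' = κ * tau χ₁⁻¹ / tau η₁⁻¹ * dedekindSum η₁ η₂ γ := by
  have hτ : tau η₁⁻¹ ≠ 0 := by
    rw [← norm_ne_zero_iff, norm_tau_inv hη₁]
    exact (Real.sqrt_pos.2 (Nat.cast_pos.2 (NeZero.pos p₁))).ne'
  rw [dedekindSum, dedekindSum, phi_mul_eq hΔ hK (psi_eq_one hp₁ hp₂ η₁ η₂ hγ)
    (psi_eq_one (dvd_mul_right _ _) (dvd_mul_left _ _) χ₁ χ₂ hγ') hW
    (phi_eq_of_mem_Gamma0 hχ₁ hχ₂ hparity hN (CongruenceSubgroup.Gamma1_in_Gamma0 _ hγ'))]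
  field_simp

/-- The reciprocity formula for the Fricke involution. -/
theorem dedekindSum_fricke {q₁ q₂ : ℕ} [NeZero q₁] [NeZero q₂] {χ₁ : DirichletCharacter ℂ q₁}
    {χ₂ : DirichletCharacter ℂ q₂} (hχ₁ : χ₁.IsPrimitive) (hχ₂ : χ₂.IsPrimitive)
    (hparity : χ₁ (-1) * χ₂ (-1) = 1) (hN : q₁ * q₂ ≠ 1) {γ γ' : SL(2, ℤ)}
    (hγ : γ ∈ CongruenceSubgroup.Gamma1 (q₁ * q₂)) (hγ' : γ' ∈ CongruenceSubgroup.Gamma1 (q₁ * q₂))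
    (hW : fricke (q₁ * q₂) * (γ : Matrix (Fin 2) (Fin 2) ℤ) =
      (γ' : Matrix (Fin 2) (Fin 2) ℤ) * fricke (q₁ * q₂)) :
    dedekindSum χ₂ χ₁ γ' = χ₁ (-1) * dedekindSum χ₁ χ₂ γ := by
  have hcomm := mul_comm q₁ q₂
  have hsq : χ₂ (-1) * χ₂ (-1) = 1 := by rw [← map_mul, neg_one_mul, neg_neg, map_one]
  have hΔ : (0 : ℤ) < 0 * 0 - (-1) * ((q₁ * q₂ : ℕ) : ℤ) := by
    have := Nat.mul_pos (NeZero.pos q₁) (NeZero.pos q₂)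
    lia
  -- Here F for (χ₂, χ₁) is the function being transformed. The substitution (m, n) ↦ (n, -m)
  -- interchanges the two factors of the weight, and χ₂(-1) absorbs the sign.
  obtain ⟨K, hK⟩ := exists_FC_mobius_eq (dvd_mul_left q₂ q₁) (dvd_mul_right q₁ q₂)
    (dvd_mul_right q₁ q₂) (dvd_mul_left q₂ q₁) hχ₂ hχ₁ hχ₁ hχ₂ (by rwa [mul_comm]) hparity
    (hcomm ▸ hN) hN (A := 0) (B := -1) (C := (q₁ * q₂ : ℕ)) (D := 0) hΔ (k := q₁)
    (a := 0) (b := 1) (c := -1) (d := 0) (by ring) (by ring) (by ring) (by push_cast; ring)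
    (by ring) (ε := χ₂ (-1))
    (fun m n => by
      have h1 : ((0 * m + 1 * n : ℤ) : ZMod q₁) = n := by push_cast; ring
      have h2 : ((-1 * m + 0 * n : ℤ) : ZMod q₂) = -1 * m := by push_cast; ring
      rw [h1, h2, map_mul]
      linear_combination (-χ₁ n * χ₂ m) * hsq)
  have key := dedekindSum_eq_of_FC_mobius_eq hχ₂ hχ₁ hχ₁ (by rwa [mul_comm]) (hcomm ▸ hN)
    (hcomm ▸ dvd_mul_right q₁ q₂) (hcomm ▸ dvd_mul_left q₂ q₁) hΔ hK (hcomm ▸ hγ) (hcomm ▸ hγ') hW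
  rw [key]
  congr 1
  -- The multiplier is χ₂(-1)·(q₁/q₂)·τ(χ₂)τ(χ₂⁻¹) / (τ(χ₁)τ(χ₁⁻¹)), and each product of Gauss sums
  -- is χᵢ(-1)qᵢ.
  have h1 := tau_mul_tau_inv hχ₁
  have h2 := tau_mul_tau_inv hχ₂
  have hτ := tau_ne_zero hχ₁
  have hq₁ : (q₁ : ℂ) ≠ 0 := Nat.cast_ne_zero.2 (NeZero.ne q₁)
  have hq₂ : (q₂ : ℂ) ≠ 0 := Nat.cast_ne_zero.2 (NeZero.ne q₂)
  have hτ' : tau χ₁⁻¹ ≠ 0 := by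
    rintro h
    rw [h, mul_zero] at h1
    rcases mul_eq_zero.1 h1.symm with h | h
    · rw [h, zero_mul] at hparity
      exact zero_ne_one hparity
    · exact hq₁ h
  have hsq₁ : χ₁ (-1) * χ₁ (-1) = 1 := by rw [← map_mul, neg_one_mul, neg_neg, map_one]
  push_cast
  field_simp
  linear_combination q₁ * q₂ * χ₂ (-1) * h2 + q₁ * q₂ ^ 2 * hsq - q₂ ^ 2 * χ₁ (-1) * h1 -
    q₁ * q₂ ^ 2 * hsq₁

/-! ## Products of characters of coprime moduli -/

/-- The identity includes m not coprime to n: since n divides ab, such an m shares a factor with a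
or b, and both sides vanish. -/
theorem changeLevel_mul_changeLevel_intCast {a b n : ℕ} (ha : a ∣ n) (hb : b ∣ n) (hn : n ∣ a * b)
    (f : DirichletCharacter ℂ a) (g : DirichletCharacter ℂ b) (m : ℤ) :
    (DirichletCharacter.changeLevel ha f * DirichletCharacter.changeLevel hb g) (m : ZMod n) =
      f m * g m := by
  by_cases hm : IsCoprime m n
  · rw [MulChar.mul_apply, DirichletCharacter.changeLevel_eq_cast_of_dvd' _ _ hm,
      DirichletCharacter.changeLevel_eq_cast_of_dvd' _ _ hm]
  · have h0 : ¬ IsUnit (m : ZMod n) := fun h => hm ((ZMod.coe_int_isUnit_iff_isCoprime m n).1 h).symm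
    rw [MulChar.map_nonunit _ h0]
    by_cases hma : IsCoprime m a
    · have hmb : ¬ IsCoprime m b := fun hmb =>
        hm ((IsCoprime.mul_right hma hmb).of_isCoprime_of_dvd_right (by exact_mod_cast hn))
      rw [MulChar.map_nonunit g
        fun h => hmb ((ZMod.coe_int_isUnit_iff_isCoprime m b).1 h).symm, mul_zero]
    · rw [MulChar.map_nonunit f
        fun h => hma ((ZMod.coe_int_isUnit_iff_isCoprime m a).1 h).symm, zero_mul]

/-- If f came from a proper divisor of a, the product would come from a modulus smaller than ab = n.
-/
theorem isPrimitive_left_of_mul {a b n : ℕ} [NeZero n] (ha : a ∣ n) (hb : b ∣ n) (hn : n = a * b)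
    {f : DirichletCharacter ℂ a} {g : DirichletCharacter ℂ b}
    (h : (DirichletCharacter.changeLevel ha f *
      DirichletCharacter.changeLevel hb g).IsPrimitive) : f.IsPrimitive := by
  obtain ⟨hd, f₀, hf⟩ := f.factorsThrough_conductor
  have hb0 : 0 < b := Nat.pos_of_dvd_of_pos hb (NeZero.pos n)
  have hdn : f.conductor * b ∣ n := hn ▸ Nat.mul_dvd_mul_right hd b
  have hF : (DirichletCharacter.changeLevel ha f *
      DirichletCharacter.changeLevel hb g).FactorsThrough (f.conductor * b) := by
    refine ⟨hdn, DirichletCharacter.changeLevel (dvd_mul_right _ _) f₀ *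
      DirichletCharacter.changeLevel (dvd_mul_left _ _) g, ?_⟩
    rw [map_mul, ← DirichletCharacter.changeLevel_trans, ← DirichletCharacter.changeLevel_trans]
    conv_lhs => rw [hf, ← DirichletCharacter.changeLevel_trans]
  have hle : a * b ≤ f.conductor * b := by
    rw [← hn]
    exact h.symm.le.trans (Nat.sInf_le hF)
  exact le_antisymm (Nat.le_of_dvd (Nat.pos_of_dvd_of_pos ha (NeZero.pos n)) hd)
    (Nat.le_of_mul_le_mul_right hle hb0)

/-- Dividing the product by g shows that f also comes from a character modulo (conductor of the
product)·b. Hence f factors through the gcd of this with a, in which b plays no role by coprimality,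
and primitivity forces that gcd to be a. -/
theorem dvd_conductor_of_mul {a b n : ℕ} [NeZero n] (ha : a ∣ n) (hb : b ∣ n) (hn : n = a * b)
    (hab : a.Coprime b) {f : DirichletCharacter ℂ a} (g : DirichletCharacter ℂ b)
    (hf : f.IsPrimitive) :
    a ∣ (DirichletCharacter.changeLevel ha f * DirichletCharacter.changeLevel hb g).conductor := by
  set φ := DirichletCharacter.changeLevel ha f * DirichletCharacter.changeLevel hb g with hφ
  have : NeZero a := ⟨fun h => NeZero.ne n (Nat.eq_zero_of_zero_dvd (h ▸ ha))⟩
  obtain ⟨hc, φ₀, hφ₀⟩ := φ.factorsThrough_conductor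
  have hbig : n ∣ a * (φ.conductor * b) := hn.dvd.trans ⟨φ.conductor, by ring⟩
  have hfac := f.factorsThrough_gcd
    (DirichletCharacter.changeLevel (dvd_mul_right φ.conductor b) φ₀ *
      (DirichletCharacter.changeLevel (dvd_mul_left b φ.conductor) g)⁻¹) (by
      rw [map_mul, map_inv, ← DirichletCharacter.changeLevel_trans,
        ← DirichletCharacter.changeLevel_trans, eq_mul_inv_iff_mul_eq]
      have := congrArg (DirichletCharacter.changeLevel hbig) (hφ.symm.trans hφ₀)
      rwa [map_mul, ← DirichletCharacter.changeLevel_trans,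
        ← DirichletCharacter.changeLevel_trans, ← DirichletCharacter.changeLevel_trans] at this)
  rw [Nat.Coprime.gcd_mul_right_cancel_right φ.conductor hab.symm] at hfac
  have hle : a ≤ a.gcd φ.conductor := hf.symm.le.trans (Nat.sInf_le hfac)
  exact Nat.gcd_eq_left_iff_dvd.1 (le_antisymm (Nat.gcd_le_left φ.conductor (NeZero.pos a)) hle)

theorem isPrimitive_mul {a b n : ℕ} [NeZero n] (ha : a ∣ n) (hb : b ∣ n) (hn : n = a * b)
    (hab : a.Coprime b) {f : DirichletCharacter ℂ a} {g : DirichletCharacter ℂ b}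
    (hf : f.IsPrimitive) (hg : g.IsPrimitive) :
    (DirichletCharacter.changeLevel ha f * DirichletCharacter.changeLevel hb g).IsPrimitive := by
  have h1 := dvd_conductor_of_mul ha hb hn hab g hf
  have h2 := dvd_conductor_of_mul hb ha (hn.trans (mul_comm _ _)) hab.symm f hg
  rw [mul_comm] at h2
  refine Nat.dvd_antisymm (DirichletCharacter.conductor_dvd_level _) ?_
  conv_lhs => rw [hn]
  exact hab.mul_dvd_of_dvd_of_dvd h1 h2

section parts

variable {q q' Q R : ℕ} (hQR : Q.Coprime R) (hq : q ∣ Q * R)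
  (hq' : q' ∣ Q * R)

theorem isPrimitive_partQ [NeZero q] {χ : DirichletCharacter ℂ q} (hχ : χ.IsPrimitive) :
    (partQ hQR hq χ).IsPrimitive := by
  rw [← partQ_mul_partR hQR hq χ] at hχ
  exact isPrimitive_left_of_mul _ _ (eq_gcd_mul_gcd hQR hq) hχ

theorem isPrimitive_partR [NeZero q] {χ : DirichletCharacter ℂ q} (hχ : χ.IsPrimitive) :
    (partR hQR hq χ).IsPrimitive := by
  rw [← partQ_mul_partR hQR hq χ, mul_comm] at hχ
  exact isPrimitive_left_of_mul _ _ ((eq_gcd_mul_gcd hQR hq).trans (mul_comm _ _)) hχ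

theorem isPrimitive_exchange [NeZero q] [NeZero q'] {χ : DirichletCharacter ℂ q} {η : DirichletCharacter ℂ q'}
    (hχ : χ.IsPrimitive) (hη : η.IsPrimitive) : (exchange hQR hq hq' χ η).IsPrimitive :=
  isPrimitive_mul _ _ rfl ((hQR.coprime_dvd_left (Nat.gcd_dvd_right q' Q)).coprime_dvd_right
    (Nat.gcd_dvd_right q R)) (isPrimitive_partQ hQR hq' hη) (isPrimitive_partR hQR hq hχ)

theorem apply_intCast_eq_partQ_mul_partR (χ : DirichletCharacter ℂ q) (m : ℤ) :
    χ m = partQ hQR hq χ m * partR hQR hq χ m := by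
  conv_lhs => rw [← partQ_mul_partR hQR hq χ]
  exact changeLevel_mul_changeLevel_intCast _ _ (eq_gcd_mul_gcd hQR hq).dvd _ _ m

theorem exchange_intCast (χ : DirichletCharacter ℂ q) (η : DirichletCharacter ℂ q') (m : ℤ) :
    exchange hQR hq hq' χ η m = partQ hQR hq' η m * partR hQR hq χ m :=
  changeLevel_mul_changeLevel_intCast _ _ dvd_rfl _ _ m

end parts

/-! ## Atkin-Lehner operators -/

theorem gcd_mul_gcd_eq_left {q₁ q₂ Q R : ℕ} [NeZero q₁] [NeZero q₂] (hQR : Q.Coprime R)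
    (h : q₁ * q₂ = Q * R) : q₁.gcd Q * q₂.gcd Q = Q := by
  have hc : ∀ q : ℕ, (q.gcd Q).Coprime R := fun q => hQR.coprime_dvd_left (Nat.gcd_dvd_right q Q)
  have hc' : ∀ q : ℕ, (q.gcd R).Coprime Q := fun q =>
    hQR.symm.coprime_dvd_left (Nat.gcd_dvd_right q R)
  have h1 := eq_gcd_mul_gcd hQR (h ▸ dvd_mul_right q₁ q₂)
  have h2 := eq_gcd_mul_gcd hQR (h ▸ dvd_mul_left q₂ q₁)
  have h3 : q₁.gcd Q * q₂.gcd Q * (q₁.gcd R * q₂.gcd R) = Q * R := by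
    rw [← h]
    conv_rhs => rw [h1, h2]
    ring
  refine Nat.dvd_antisymm ?_ ?_
  · exact (Nat.Coprime.mul_left (hc q₁) (hc q₂)).dvd_of_dvd_mul_right (h3 ▸ dvd_mul_right _ _)
  · exact (Nat.Coprime.mul_left (hc' q₁) (hc' q₂)).symm.dvd_of_dvd_mul_right (h3 ▸ dvd_mul_right Q R)

theorem norm_apply_eq_one {q : ℕ} [NeZero q] (χ : DirichletCharacter ℂ q) {x : ZMod q}
    (hx : IsUnit x) : ‖χ x‖ = 1 := by
  obtain ⟨u, rfl⟩ := hx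
  exact χ.unit_norm_eq_one u

theorem isUnit_of_det_eq_one {q : ℕ} {a b c d : ℤ} (h : a * d - b * c = 1)
    (hq : (q : ℤ) ∣ b ∨ (q : ℤ) ∣ c) : IsUnit (a : ZMod q) ∧ IsUnit (d : ZMod q) := by
  have h0 : (b : ZMod q) * c = 0 := by
    rcases hq with hq | hq
    · rw [(ZMod.intCast_zmod_eq_zero_iff_dvd _ q).2 hq, zero_mul]
    · rw [(ZMod.intCast_zmod_eq_zero_iff_dvd _ q).2 hq, mul_zero]
  have := congrArg (Int.cast : ℤ → ZMod q) h
  push_cast at this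
  rw [h0, sub_zero] at this
  exact ⟨IsUnit.of_mul_eq_one _ this, IsUnit.of_mul_eq_one _ ((mul_comm _ _).trans this)⟩

theorem of_two_congr {x y z w x' y' z' w' : ℤ} (hx : x = x') (hy : y = y') (hz : z = z')
    (hw : w = w') : !![x, y; z, w] = !![x', y'; z', w'] := by
  rw [hx, hy, hz, hw]

/-- Conjugation by an Atkin-Lehner operator preserves `Γ₁(N)`. -/
theorem existsUnique_conj_mem_Gamma1 {Q R : ℕ} (hQ : Q ≠ 0) {r t u v : ℤ}
    (hdet : Q * r * v - R * u * t = 1) {γ : SL(2, ℤ)}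
    (hγ : γ ∈ CongruenceSubgroup.Gamma1 (Q * R)) :
    ∃! γ' : SL(2, ℤ), γ' ∈ CongruenceSubgroup.Gamma1 (Q * R) ∧
      !![Q * r, t; (Q * R) * u, Q * v] * (γ : Matrix (Fin 2) (Fin 2) ℤ) =
        (γ' : Matrix (Fin 2) (Fin 2) ℤ) * !![Q * r, t; (Q * R) * u, Q * v] := by
  have hQ' : (Q : ℤ) ≠ 0 := Int.natCast_ne_zero.2 hQ
  obtain ⟨h00, h11, h10⟩ := (CongruenceSubgroup.Gamma1_mem _ _).1 hγ
  obtain ⟨e, he⟩ := (ZMod.intCast_zmod_eq_zero_iff_dvd _ _).1 h10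
  push_cast at he
  set a := γ 0 0
  set b := γ 0 1
  set c := γ 1 0
  set d := γ 1 1
  have hγm : (γ : Matrix (Fin 2) (Fin 2) ℤ) = !![a, b; c, d] := Matrix.eta_fin_two _
  -- This is Wγ·adj(W)/Q, that is WγW⁻¹; writing c = QRe makes the division by Q integral.
  let M : Matrix (Fin 2) (Fin 2) ℤ :=
    !![Q * r * v * a + t * c * v - Q * r * b * R * u - R * u * t * d,
      -r * a * t + Q * r ^ 2 * b + t * d * r - t ^ 2 * R * e;
      Q * R * (u * a * v + Q * v ^ 2 * e - R * u ^ 2 * b - u * v * d),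
      -R * u * a * t - v * c * t + Q * R * u * b * r + Q * r * v * d]
  have hM : !![Q * r, t; (Q * R) * u, Q * v] * (γ : Matrix (Fin 2) (Fin 2) ℤ) =
      M * !![Q * r, t; (Q * R) * u, Q * v] := by
    rw [hγm]
    simp only [M, Matrix.mul_fin_two]
    refine of_two_congr ?_ ?_ ?_ ?_
    · linear_combination -(Q * r * a + t * c) * hdet - R * u * t ^ 2 * he
    · linear_combination -(Q * r * b + t * d) * hdet - t ^ 2 * v * he
    · linear_combination -(Q * R * u * a + Q * v * c) * hdet + Q ^ 2 * v ^ 2 * r * he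
    · linear_combination -(Q * R * u * b + Q * v * d) * hdet + Q * v ^ 2 * t * he
  have hWdet : (!![Q * r, t; (Q * R) * u, Q * v] : Matrix (Fin 2) (Fin 2) ℤ).det = Q := by
    rw [Matrix.det_fin_two_of]
    linear_combination Q * hdet
  have hMdet : M.det = 1 := by
    have := congrArg Matrix.det hM
    rw [Matrix.det_mul, Matrix.det_mul, γ.det_coe, hWdet, mul_one] at this
    exact mul_right_cancel₀ hQ' (by rw [one_mul, ← this])
  have hdet' := congrArg (Int.cast : ℤ → ZMod (Q * R)) hdet
  have hQR0 : (Q * R : ZMod (Q * R)) = 0 := by exact_mod_cast ZMod.natCast_self (Q * R)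
  push_cast at hdet'
  let M' : SL(2, ℤ) := ⟨M, hMdet⟩
  refine ⟨M', ⟨?_, hM⟩, fun γ'' h => ?_⟩
  · refine (CongruenceSubgroup.Gamma1_mem _ _).2 ⟨?_, ?_, ?_⟩
    · change ((Q * r * v * a + t * c * v - Q * r * b * R * u - R * u * t * d : ℤ) :
        ZMod (Q * R)) = 1
      push_cast
      rw [h00, h11, h10]
      linear_combination hdet' - r * b * u * hQR0
    · change ((-R * u * a * t - v * c * t + Q * R * u * b * r + Q * r * v * d : ℤ) :
        ZMod (Q * R)) = 1
      push_cast
      rw [h00, h11, h10]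
      linear_combination hdet' + r * b * u * hQR0
    · change ((Q * R * (u * a * v + Q * v ^ 2 * e - R * u ^ 2 * b - u * v * d) : ℤ) :
        ZMod (Q * R)) = 0
      push_cast
      rw [hQR0, zero_mul]
  · refine Subtype.ext ?_
    have h2 := h.2.symm.trans hM
    have h3 := congrArg (· * Matrix.adjugate !![Q * r, t; (Q * R) * u, Q * v]) h2
    simp only [Matrix.mul_assoc, Matrix.mul_adjugate, hWdet] at h3
    simp only [Matrix.mul_smul, Matrix.mul_one] at h3
    exact smul_right_injective _ hQ' h3

/-- The multiplier by which the linear substitution attached to an Atkin-Lehner operator changes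
the weight `χ₁ ⊗ χ₂` into the exchanged one. -/
theorem exists_exchange_multiplier {q₁ q₂ Q R : ℕ} [NeZero q₁] [NeZero q₂] (hQR : Q.Coprime R)
    (hq₁ : q₁ ∣ Q * R) (hq₂ : q₂ ∣ Q * R) (χ₁ : DirichletCharacter ℂ q₁)
    (χ₂ : DirichletCharacter ℂ q₂) {a b c d : ℤ} (hdet : a * d - b * c = 1)
    (ha : ((q₂.gcd Q : ℕ) : ℤ) ∣ a) (hb : ((q₁.gcd R : ℕ) : ℤ) ∣ b)
    (hc : ((q₂.gcd R : ℕ) : ℤ) ∣ c) (hd : ((q₁.gcd Q : ℕ) : ℤ) ∣ d) :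
    ∃ ε : ℂ, ‖ε‖ = 1 ∧ ∀ m n : ℤ, χ₁ m * χ₂ n =
      ε * (exchange hQR hq₁ hq₂ χ₁ χ₂ ((a * m + b * n : ℤ) : ZMod (q₂.gcd Q * q₁.gcd R)) *
        exchange hQR hq₂ hq₁ χ₂ χ₁ ((c * m + d * n : ℤ) : ZMod (q₁.gcd Q * q₂.gcd R))) := by
  -- Rearranged so that b and c take the place of the diagonal entries, which shows that they are
  -- units modulo (q₂, Q) and (q₁, Q) respectively.
  have hdet' : (-b) * c - (-a) * d = 1 := by linear_combination hdet
  have u₁ := norm_apply_eq_one (partQ hQR hq₂ χ₂)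
    ((isUnit_of_det_eq_one hdet' (Or.inl (dvd_neg.2 ha))).1.neg)
  have u₂ := norm_apply_eq_one (partR hQR hq₁ χ₁) (isUnit_of_det_eq_one hdet (Or.inl hb)).1
  have u₃ := norm_apply_eq_one (partQ hQR hq₁ χ₁) (isUnit_of_det_eq_one hdet' (Or.inr hd)).2
  have u₄ := norm_apply_eq_one (partR hQR hq₂ χ₂) (isUnit_of_det_eq_one hdet (Or.inr hc)).2
  rw [Int.cast_neg, neg_neg] at u₁
  have hcast : ∀ {q : ℕ} {x : ℤ}, (q : ℤ) ∣ x → (x : ZMod q) = 0 := fun {q x} h =>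
    (ZMod.intCast_zmod_eq_zero_iff_dvd _ q).2 h
  -- By the divisibilities am + bn is bn modulo (q₂, Q) and am modulo (q₁, R), while cm + dn is cm
  -- modulo (q₁, Q) and dn modulo (q₂, R). The values at the coefficients are collected in `δ`.
  set δ := partQ hQR hq₂ χ₂ b * partR hQR hq₁ χ₁ a * partQ hQR hq₁ χ₁ c * partR hQR hq₂ χ₂ d with hδ
  have hnorm : ‖δ‖ = 1 := by
    rw [hδ, norm_mul, norm_mul, norm_mul, u₁, u₂, u₃, u₄]
    norm_num
  have hδ0 : δ ≠ 0 := norm_ne_zero_iff.1 (hnorm ▸ one_ne_zero)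
  refine ⟨δ⁻¹, by rw [norm_inv, hnorm, inv_one], fun m n => ?_⟩
  rw [eq_inv_mul_iff_mul_eq₀ hδ0, exchange_intCast, exchange_intCast,
    apply_intCast_eq_partQ_mul_partR hQR hq₁ χ₁, apply_intCast_eq_partQ_mul_partR hQR hq₂ χ₂]
  push_cast
  rw [hcast ha, hcast hb, hcast hc, hcast hd]
  simp only [zero_mul, zero_add, add_zero, map_mul]
  rw [hδ]
  ring

/-- Here a, b, c, d stand for (q₁, Q), (q₁, R), (q₂, Q), (q₂, R), so Q = ac, q₁ = ab, q₂ = cd, and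
the exchanged moduli are cb and ad. The left side is |ξ|. -/
theorem norm_multiplier {a b c d : ℕ} [NeZero a] [NeZero b] [NeZero c] [NeZero d] :
    (a * c : ℝ) / c ^ 2 * ((c * d) ^ 2 / √(c * d)) * (√(a * d) / (a * d) ^ 2) * √(a * b) /
      √(c * b) = 1 := by
  have hpos : ∀ (n : ℕ) [NeZero n], (0 : ℝ) < n := fun n _ => Nat.cast_pos.2 (NeZero.pos n)
  have key : ∀ x y z w : ℝ, 0 < x → 0 < y → 0 < z → 0 < w →
      (x ^ 2 * z ^ 2) / (z ^ 2) ^ 2 * ((z ^ 2 * w ^ 2) ^ 2 / (z * w)) *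
        ((x * w) / (x ^ 2 * w ^ 2) ^ 2) * (x * y) / (z * y) = 1 := by
    intro x y z w hx hy hz hw
    field_simp
  have := key √a √b √c √d (Real.sqrt_pos.2 (hpos a)) (Real.sqrt_pos.2 (hpos b))
    (Real.sqrt_pos.2 (hpos c)) (Real.sqrt_pos.2 (hpos d))
  simp only [Real.sq_sqrt (Nat.cast_nonneg _)] at this
  rwa [← Real.sqrt_mul (Nat.cast_nonneg c), ← Real.sqrt_mul (Nat.cast_nonneg a),
    ← Real.sqrt_mul (Nat.cast_nonneg a), ← Real.sqrt_mul (Nat.cast_nonneg c)] at this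

/-- The reciprocity formula for Atkin-Lehner operators. -/
theorem exists_dedekindSum_exchange {q₁ q₂ : ℕ} [NeZero q₁] [NeZero q₂]
    {χ₁ : DirichletCharacter ℂ q₁} {χ₂ : DirichletCharacter ℂ q₂}
    (hχ₁ : χ₁.IsPrimitive) (hχ₂ : χ₂.IsPrimitive) (hparity : χ₁ (-1) * χ₂ (-1) = 1)
    (hN : q₁ * q₂ ≠ 1) {Q R : ℕ} (hQR : Q.Coprime R) (h : q₁ * q₂ = Q * R) (hq₁ : q₁ ∣ Q * R)
    (hq₂ : q₂ ∣ Q * R) {r t u v : ℤ} (hdet : Q * r * v - R * u * t = 1) :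
    ∃ ξ : ℂ, ‖ξ‖ = 1 ∧ ∀ γ ∈ CongruenceSubgroup.Gamma1 (q₁ * q₂),
      ∀ γ' ∈ CongruenceSubgroup.Gamma1 (q₁ * q₂),
        !![Q * r, t; (Q * R) * u, Q * v] * (γ : Matrix (Fin 2) (Fin 2) ℤ) =
          (γ' : Matrix (Fin 2) (Fin 2) ℤ) * !![Q * r, t; (Q * R) * u, Q * v] →
        dedekindSum χ₁ χ₂ γ' = ξ * dedekindSum (exchange hQR hq₁ hq₂ χ₁ χ₂)
          (exchange hQR hq₂ hq₁ χ₂ χ₁) γ := by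
  have hRQ : R.Coprime Q := hQR.symm
  have hQeq := gcd_mul_gcd_eq_left hQR h
  have hReq := gcd_mul_gcd_eq_left hRQ (h.trans (mul_comm _ _))
  have hq₁eq := eq_gcd_mul_gcd hQR hq₁
  have hq₂eq := eq_gcd_mul_gcd hQR hq₂
  have hη₁ := isPrimitive_exchange hQR hq₁ hq₂ hχ₁ hχ₂
  have hη₂ := isPrimitive_exchange hQR hq₂ hq₁ hχ₂ hχ₁
  have hη : exchange hQR hq₁ hq₂ χ₁ χ₂ (-1) * exchange hQR hq₂ hq₁ χ₂ χ₁ (-1) = 1 := by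
    have e₁ := exchange_intCast hQR hq₁ hq₂ χ₁ χ₂ (-1)
    have e₂ := exchange_intCast hQR hq₂ hq₁ χ₂ χ₁ (-1)
    have e₃ := apply_intCast_eq_partQ_mul_partR hQR hq₁ χ₁ (-1)
    have e₄ := apply_intCast_eq_partQ_mul_partR hQR hq₂ χ₂ (-1)
    push_cast at e₁ e₂ e₃ e₄
    rw [e₃, e₄] at hparity
    rw [e₁, e₂, ← hparity]
    ring
  have hpp : q₂.gcd Q * q₁.gcd R * (q₁.gcd Q * q₂.gcd R) = q₁ * q₂ := by
    conv_rhs => rw [hq₁eq, hq₂eq]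
    ring
  -- With p₂ = (q₁, Q)(q₂, R), the matrix diag(q₂, 1)·W_Q·diag(p₂, 1)⁻¹ is (q₂, Q) times an integral
  -- matrix of determinant one; these are its entries.
  have hdet₂ : (q₂.gcd Q * r : ℤ) * (q₁.gcd Q * v) - (q₁.gcd R * u) * (q₂.gcd R * t) = 1 := by
    have h1 : (q₁.gcd Q * q₂.gcd Q : ℤ) = Q := by exact_mod_cast hQeq
    have h2 : (q₁.gcd R * q₂.gcd R : ℤ) = R := by exact_mod_cast hReq
    linear_combination hdet + r * v * h1 - u * t * h2
  obtain ⟨ε, hε, hεeq⟩ := exists_exchange_multiplier hQR hq₁ hq₂ χ₁ χ₂ hdet₂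
    (dvd_mul_right _ _) (dvd_mul_right _ _) (dvd_mul_right _ _) (dvd_mul_right _ _)
  have hQpos : 0 < Q := Nat.pos_of_ne_zero fun h0 => by
    rw [h0, zero_mul] at h
    exact (Nat.mul_pos (NeZero.pos q₁) (NeZero.pos q₂)).ne' h
  have hΔeq : (Q * r) * (Q * v) - t * ((Q * R) * u) = (Q : ℤ) := by
    linear_combination Q * hdet
  have hΔ : 0 < (Q * r) * (Q * v) - t * ((Q * R) * u) := by
    rw [hΔeq]
    exact_mod_cast hQpos
  have hq₁eq' : (q₁ : ℤ) = q₁.gcd Q * q₁.gcd R := by exact_mod_cast hq₁eq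
  have hq₂eq' : (q₂ : ℤ) = q₂.gcd Q * q₂.gcd R := by exact_mod_cast hq₂eq
  have hQeq' : (Q : ℤ) = q₁.gcd Q * q₂.gcd Q := by exact_mod_cast hQeq.symm
  have hReq' : (R : ℤ) = q₁.gcd R * q₂.gcd R := by exact_mod_cast hReq.symm
  obtain ⟨K, hK⟩ := exists_FC_mobius_eq (dvd_mul_right q₁ q₂) (dvd_mul_left q₂ q₁)
    (hpp ▸ dvd_mul_right _ _) (hpp ▸ dvd_mul_left _ _) hχ₁ hχ₂ hη₁ hη₂ hparity hη hN
    (hpp ▸ hN) hΔ (k := q₂.gcd Q) hdet₂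
    (by
      push_cast
      linear_combination (Q * r : ℤ) * hq₂eq' + q₂.gcd Q * q₂.gcd R * r * hQeq')
    (by linear_combination t * hq₂eq')
    (by
      push_cast
      linear_combination R * u * hQeq' + q₁.gcd Q * q₂.gcd Q * u * hReq')
    (by linear_combination v * hQeq') hεeq
  -- The witness is κ·τ(χ₁⁻¹)/τ(χ₁'⁻¹), which involves only the characters and W_Q.
  refine ⟨_, ?_, fun γ hγ γ' hγ' hW => dedekindSum_eq_of_FC_mobius_eq hχ₁ hχ₂ hη₁ hparity hN
    (hpp ▸ dvd_mul_right _ _) (hpp ▸ dvd_mul_left _ _) hΔ hK hγ hγ' hW⟩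
  have hΔ' : (((Q * r : ℤ) : ℂ) * ((Q * v : ℤ) : ℂ) - (t : ℂ) * (((Q * R) * u : ℤ) : ℂ)) = (Q : ℂ) := by
    exact_mod_cast congrArg (Int.cast : ℤ → ℂ) hΔeq
  rw [hΔ']
  simp only [norm_div, norm_mul, norm_pow, norm_natCast, hε, norm_tau hχ₂, norm_tau hη₂,
    norm_tau_inv hχ₁, norm_tau_inv hη₁]
  have hQr : (Q : ℝ) = q₁.gcd Q * q₂.gcd Q := by exact_mod_cast hQeq.symm
  have hq₁r : (q₁ : ℝ) = q₁.gcd Q * q₁.gcd R := by exact_mod_cast hq₁eq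
  have hq₂r : (q₂ : ℝ) = q₂.gcd Q * q₂.gcd R := by exact_mod_cast hq₂eq
  have := norm_multiplier (a := q₁.gcd Q) (b := q₁.gcd R) (c := q₂.gcd Q) (d := q₂.gcd R)
  rw [← hQr, ← hq₁r, ← hq₂r] at this
  push_cast
  rw [mul_one]
  exact this

end NewformDedekind

end

theorem theorem1p1 {q₁ q₂ : ℕ} [NeZero q₁] [NeZero q₂]
    (χ₁ : DirichletCharacter ℂ q₁) (χ₂ : DirichletCharacter ℂ q₂)
    (hχ₁ : χ₁.IsPrimitive) (hχ₂ : χ₂.IsPrimitive)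
    (hparity : χ₁ (-1) * χ₂ (-1) = 1) (hN : 1 < q₁ * q₂) :
    -- the Dedekind sum is well defined on `Γ₀(N)`: `φ(γ, z)` does not depend on `z`
    (∀ γ ∈ CongruenceSubgroup.Gamma0 (q₁ * q₂), ∀ z w : UpperHalfPlane,
      NewformDedekind.phi χ₁ χ₂ γ z = NewformDedekind.phi χ₁ χ₂ γ w) ∧
    -- the reciprocity formula for every Atkin-Lehner operator
    (∀ (Q R : ℕ) (hQR : Q.Coprime R) (hNQR : q₁ * q₂ = Q * R) (r₀ u₀ : ℤ),
      IsCoprime r₀ (R : ℤ) → IsCoprime u₀ (Q : ℤ) →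
      ∀ W : Matrix (Fin 2) (Fin 2) ℤ, NewformDedekind.IsAtkinLehner Q R r₀ u₀ W →
        (∀ γ ∈ CongruenceSubgroup.Gamma1 (q₁ * q₂),
          ∃! γ' : Matrix.SpecialLinearGroup (Fin 2) ℤ,
            γ' ∈ CongruenceSubgroup.Gamma1 (q₁ * q₂) ∧
              W * (γ : Matrix (Fin 2) (Fin 2) ℤ) = (γ' : Matrix (Fin 2) (Fin 2) ℤ) * W) ∧
        ∃ ξ : ℂ, ‖ξ‖ = 1 ∧
          ∀ γ ∈ CongruenceSubgroup.Gamma1 (q₁ * q₂),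
          ∀ γ' ∈ CongruenceSubgroup.Gamma1 (q₁ * q₂),
            W * (γ : Matrix (Fin 2) (Fin 2) ℤ) = (γ' : Matrix (Fin 2) (Fin 2) ℤ) * W →
            NewformDedekind.dedekindSum χ₁ χ₂ γ' =
              ξ * NewformDedekind.dedekindSum
                (NewformDedekind.exchange hQR (hNQR ▸ Nat.dvd_mul_right q₁ q₂)
                  (hNQR ▸ Nat.dvd_mul_left q₂ q₁) χ₁ χ₂)
                (NewformDedekind.exchange hQR (hNQR ▸ Nat.dvd_mul_left q₂ q₁)
                  (hNQR ▸ Nat.dvd_mul_right q₁ q₂) χ₂ χ₁) γ) ∧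
    -- the special case of the Fricke involution
    (∀ γ ∈ CongruenceSubgroup.Gamma1 (q₁ * q₂), ∀ γ' ∈ CongruenceSubgroup.Gamma1 (q₁ * q₂),
      NewformDedekind.fricke (q₁ * q₂) * (γ : Matrix (Fin 2) (Fin 2) ℤ) =
        (γ' : Matrix (Fin 2) (Fin 2) ℤ) * NewformDedekind.fricke (q₁ * q₂) →
      (χ₁.Even ∧ χ₂.Even →
        NewformDedekind.dedekindSum χ₁ χ₂ γ = NewformDedekind.dedekindSum χ₂ χ₁ γ') ∧
      (χ₁.Odd ∧ χ₂.Odd →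
        NewformDedekind.dedekindSum χ₁ χ₂ γ = -NewformDedekind.dedekindSum χ₂ χ₁ γ')) := by
  have hN' := hN.ne'
  refine ⟨fun γ hγ z w => NewformDedekind.phi_eq_of_mem_Gamma0 hχ₁ hχ₂ hparity hN' hγ z w, ?_, ?_⟩
  · rintro Q R hQR h r₀ u₀ - - W ⟨r, t, u, v, -, -, hdet, rfl⟩
    refine ⟨fun γ hγ => ?_, NewformDedekind.exists_dedekindSum_exchange hχ₁ hχ₂ hparity hN' hQR h
      _ _ hdet⟩
    rw [h] at hγ ⊢
    exact NewformDedekind.existsUnique_conj_mem_Gamma1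
      (left_ne_zero_of_mul (h ▸ (zero_lt_one.trans hN).ne')) hdet hγ
  · intro γ hγ γ' hγ' hW
    have key := NewformDedekind.dedekindSum_fricke hχ₁ hχ₂ hparity hN' hγ hγ' hW
    refine ⟨fun he => ?_, fun ho => ?_⟩
    · rw [key, show χ₁ (-1) = 1 from he.1, one_mul]
    · rw [key, show χ₁ (-1) = -1 from ho.1, neg_one_mul, neg_neg]
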